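/- Let $G=(V,E)$ be a finite simple undirected graph and $M$ a matching in $G$. An augmenting path is a simple path with at least one edge joining two free (unmatched) vertices whose edges alternate between $E\setminus M$ and $M$; a sap is an augmenting path with the minimum number of edges. **Search.** Vertices are even, odd or unlabeled; even vertices $v$ carry a number $\mathrm{lcp}(v)$ and vertices born odd a number $\mathrm{lcp}_{odd}(v)$. The labeled vertices form alternating trees whose nodes are single odd vertices and blossoms (disjoint sets of even vertices); unlabeled vertices are blocks of size one. In phase $0$ every free vertex becomes even with $\mathrm{lcp}=0$ and is the root of a tree. Phase $\Delta\ge 1$ proceeds as follows (all choices are arbitrary). * If $\Delta$ is even: as long as there is an edge $uv$ with $u$ even, $\mathrm{lcp}(u)=\Delta-2$, and $v$ unlabeled, make $v$ an odd child of the node containing $u$ and its mate $w$ an even child of $v$, with $\mathrm{lcp}_{odd}(v)=\mathrm{lcp}(u)+1$ and $\mathrm{lcp}(w)=\mathrm{lcp}(u)+2$. * Then, as long as there is a non-matching edge $xy$ with $x,y$ even, in different maximal blossoms, and $\mathrm{lcp}(x)+\mathrm{lcp}(y)=2\Delta-2$, choose one. If $x$ and $y$ lie in different trees, the search stops; $\Delta$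 is then called the breakthrough phase. Otherwise unite all nodes on the tree paths from the nodes of $x$ and $y$ to their lowest common ancestor into one blossom, whose base is the base of that ancestor; every odd vertex $z$ on these paths becomes even with $\mathrm{lcp}(z)=\mathrm{lcp}(x)+1+\mathrm{lcp}(y)-\mathrm{lcp}_{odd}(z)$. **The graph $H$.** Suppose that some execution has breakthrough phase $\Delta$, and take blossoms, labels, $\mathrm{lcp}$ and $\mathrm{lcp}_{odd}$ as they are at the beginning of phase $\Delta$ (equivalently, at the end of phase $\Delta-1$). The nodes of $H$ are the maximal blossoms, together with the single odd and the single unlabeled vertices. An edge $uv\in E$ whose endpoints lie in different nodes $u_H\neq v_H$ yields an edge of $H$ between $u_H$ and $v_H$ exactly in the following cases (for one of the two orders of its endpoints): * $u,v$ are even and $\mathrm{lcp}(u)+\mathrm{lcp}(v)=2\Delta-2$; * $u$ is even, $v$ is odd, $uv\notin M$ and $\mathrm{lcp}_{odd}(v)=\mathrm{lcp}(u)+1$; * $u$ is even, $v$ is odd, $uv\in M$ and $\mathrm{lcp}(u)=\mathrm{lcp}_{odd}(v)+1$; * $u,v$ are unlabeled and $uv\in M$; * $u$ is even, $v$ is unlabeled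 and $\mathrm{lcp}(u)=\Delta-2$. $H$ is a multigraph: each of its edges is identified with the edge of $G$ from which it arises, and its matching consists of those of its edges that lie in $M$. The image in $H$ of a path of $G$ is the set of its edges that have their endpoints in different nodes of $H$. **Lemma.** A set $P$ of edges is the edge set of an augmenting path in $H$ (with respect to the matching of $H$) if and only if $P$ is the image of a sap $Q$ in $G$. -/

import Mathlib

namespace CardMatching

universe u v

/-! ## Augmenting paths in a simple graph -/

section SimpleGraphPaths

variable {V : Type u} {G : SimpleGraph V}

/-- A vertex is free (unmatched) with respect to the matching `M`. -/
def IsFree (M : G.Subgraph) (x : V) : Prop := ∀ y, ¬ M.Adj x y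

/-- An augmenting path with respect to `M`: a simple path with at least one edge that joins two
free vertices and whose edges are alternately in `M` and not in `M`. -/
def IsAugmentingPath (M : G.Subgraph) {x y : V} (Q : G.Walk x y) : Prop :=
  Q.IsPath ∧ 0 < Q.length ∧ IsFree M x ∧ IsFree M y ∧
    List.IsChain (fun e e' => e ∈ M.edgeSet ↔ e' ∉ M.edgeSet) Q.edges

/-- A shortest augmenting path (sap) with respect to `M`. -/
def IsShortestAugmentingPath (M : G.Subgraph) {x y : V} (Q : G.Walk x y) : Prop :=
  IsAugmentingPath M Q ∧
    ∀ (x' y' : V) (Q' : G.Walk x' y'), IsAugmentingPath M Q' → Q.length ≤ Q'.length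

end SimpleGraphPaths

/-! ## Augmenting paths in a multigraph -/

section MultigraphPaths

variable {α : Type u} {β : Type v}

/-- A vertex of the multigraph `H` that is incident to no edge of `N`. -/
def IsFreeIn (H : Graph α β) (N : Set β) (x : α) : Prop :=
  x ∈ H.vertexSet ∧ ∀ e ∈ N, ¬ H.Inc e x

/-- The edge set `P` forms an augmenting path in the multigraph `H` with respect to the set `N` of
matching edges: `P` is the set of edges `e 0, …, e k` of a simple path with vertices
`x 0, …, x (k + 1)` whose edges are alternately in `N` and not in `N` and whose two ends are
free. -/
def FormsAugmentingPath (H : Graph α β) (N : Set β) (P : Set β) : Prop :=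
  ∃ (k : ℕ) (x : Fin (k + 2) → α) (e : Fin (k + 1) → β),
    Function.Injective x ∧
    (∀ i : Fin (k + 1), H.IsLink (e i) (x i.castSucc) (x i.succ)) ∧
    (∀ i : Fin k, e i.castSucc ∈ N ↔ e i.succ ∉ N) ∧
    IsFreeIn H N (x 0) ∧ IsFreeIn H N (x (Fin.last (k + 1))) ∧
    P = Set.range e

end MultigraphPaths

/-! ## The search structures -/

/-- The label of a vertex. -/
inductive Label : Type where
  | unlabeled
  | odd
  | even

/-- A state of the search. The nodes of the search structures, and the unlabeled vertices, are
represented by the vertices `b` with `base b = b`; such a `b` stands for the block of all vertices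
`w` with `base w = b`. -/
structure SearchState (V : Type u) where
  /-- the current label of a vertex -/
  label : V → Label
  /-- length of the canonical path of an even vertex (meaningless for other vertices) -/
  lcp : V → ℕ
  /-- length of the canonical path of an odd vertex (meaningless for vertices not born odd) -/
  lcpOdd : V → ℕ
  /-- the base of the maximal blossom containing an even vertex; any other vertex is its own base -/
  base : V → V
  /-- for a vertex born odd, the vertex out of which it was grown (meaningless otherwise) -/
  par : V → V

section Search

variable {V : Type u} {G : SimpleGraph V}

open Classical in
/-- The state after phase zero: the free vertices are the roots, with `lcp`-value zero. -/
noncomputable def initState (M : G.Subgraph) : SearchState V where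
  label x := if IsFree M x then Label.even else Label.unlabeled
  lcp _ := 0
  lcpOdd _ := 0
  base := id
  par := id

/-- Node `p` is the parent of node `c` in its search structure. The parent of an odd node is the
node containing the vertex out of which it was grown; the parent of a blossom is the mate of
its base. -/
def IsParent (M : G.Subgraph) (s : SearchState V) (p c : V) : Prop :=
  (s.label c = Label.odd ∧ p = s.base (s.par c)) ∨
    (s.label c = Label.even ∧ s.base c = c ∧ M.Adj c p)

/-- Node `a` is a (not necessarily proper) ancestor of node `c`. -/
def IsAncestor (M : G.Subgraph) (s : SearchState V) (a c : V) : Prop :=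
  Relation.ReflTransGen (fun c' p => IsParent M s p c') c a

/-- Node `b` is the lowest common ancestor of the nodes `a` and `c`. -/
def IsLowestCommonAncestor (M : G.Subgraph) (s : SearchState V) (b a c : V) : Prop :=
  IsAncestor M s b a ∧ IsAncestor M s b c ∧
    ∀ d, IsAncestor M s d a → IsAncestor M s d c → IsAncestor M s d b

/-- The labeled vertices `x` and `y` belong to the same search structure: their nodes have the
same root, where roots are represented by free vertices. -/
def SameTree (M : G.Subgraph) (s : SearchState V) (x y : V) : Prop :=
  ∃ r, IsFree M r ∧ IsAncestor M s r (s.base x) ∧ IsAncestor M s r (s.base y)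

open Classical in
/-- Make `v` an odd child of (the node containing) `u`, and `w` an even child of `v`. -/
noncomputable def SearchState.grow (s : SearchState V) (u v w : V) : SearchState V where
  label := Function.update (Function.update s.label v Label.odd) w Label.even
  lcp := Function.update s.lcp w (s.lcp u + 2)
  lcpOdd := Function.update s.lcpOdd v (s.lcp u + 1)
  base := s.base
  par := Function.update s.par v u

/-- A growth-step of phase `Δ` from state `s` to state `t`: it grows out of an even vertex `u` with
`lcp`-value `Δ - 2` to an unlabeled neighbor `v` and on to the mate `w` of `v`. -/
def IsGrowthStep (M : G.Subgraph) (Δ : ℕ) (s t : SearchState V) : Prop :=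
  ∃ u v w, s.label u = Label.even ∧ s.lcp u + 2 = Δ ∧ G.Adj u v ∧
    s.label v = Label.unlabeled ∧ M.Adj v w ∧ t = s.grow u v w

/-- An even-even non-matching edge between different maximal blossoms that is to be processed in
phase `Δ`, i.e., with `lcp`-sum `2 * Δ - 2`. -/
def IsBridge (M : G.Subgraph) (Δ : ℕ) (s : SearchState V) (x y : V) : Prop :=
  G.Adj x y ∧ ¬ M.Adj x y ∧ s.label x = Label.even ∧ s.label y = Label.even ∧
    s.base x ≠ s.base y ∧ s.lcp x + s.lcp y + 2 = 2 * Δ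

/-- The nodes on the tree paths from the nodes of `x` and `y` up to their common ancestor `b`. -/
def cycleNodes (M : G.Subgraph) (s : SearchState V) (x y b : V) : Set V :=
  {z | IsAncestor M s b z ∧ (IsAncestor M s z (s.base x) ∨ IsAncestor M s z (s.base y))}

open Classical in
/-- Shrink the blossom closed by the edge `xy`, with base `b`: all nodes on the cycle are united,
and the odd ones become even. -/
noncomputable def SearchState.shrink (M : G.Subgraph) (s : SearchState V) (x y b : V) :
    SearchState V where
  label z := if z ∈ cycleNodes M s x y b then Label.even else s.label z
  lcp z := if z ∈ cycleNodes M s x y b ∧ s.label z = Label.odd then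
    s.lcp x + 1 + s.lcp y - s.lcpOdd z else s.lcp z
  lcpOdd := s.lcpOdd
  base z := if s.base z ∈ cycleNodes M s x y b then b else s.base z
  par := s.par

/-- A blossom-forming bridge-step of phase `Δ` from state `s` to state `t`. -/
def IsBlossomStep (M : G.Subgraph) (Δ : ℕ) (s t : SearchState V) : Prop :=
  ∃ x y b, IsBridge M Δ s x y ∧ SameTree M s x y ∧
    IsLowestCommonAncestor M s b (s.base x) (s.base y) ∧ t = s.shrink M x y b

/-- The growth part of phase `Δ`: if `Δ` is even, growth-steps are performed, in any order, until
none is possible; if `Δ` is odd, nothing happens. -/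
def GrowthPart (M : G.Subgraph) (Δ : ℕ) (s t : SearchState V) : Prop :=
  (Even Δ ∧ Relation.ReflTransGen (IsGrowthStep M Δ) s t ∧ ∀ t', ¬ IsGrowthStep M Δ t t') ∨
    (¬ Even Δ ∧ t = s)

/-- Phase `Δ` (with `Δ ≥ 1`) can lead from `s` to `t` without a breakthrough: after the growth part,
bridges are processed, in any order, until no bridge is left, and all of them close blossoms. -/
def PhaseCompletes (M : G.Subgraph) (Δ : ℕ) (s t : SearchState V) : Prop :=
  ∃ s', GrowthPart M Δ s s' ∧ Relation.ReflTransGen (IsBlossomStep M Δ) s' t ∧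
    ∀ x y, ¬ IsBridge M Δ t x y

/-- Phase `Δ` (with `Δ ≥ 1`), started in state `s`, can find a bridge that joins two distinct
search structures. -/
def PhaseBreaksThrough (M : G.Subgraph) (Δ : ℕ) (s : SearchState V) : Prop :=
  ∃ s' t x y, GrowthPart M Δ s s' ∧ Relation.ReflTransGen (IsBlossomStep M Δ) s' t ∧
    IsBridge M Δ t x y ∧ ¬ SameTree M t x y

/-- `s` is a possible state at the end of phase `Δ`, where phases `0, …, Δ` were completed without
a breakthrough. -/
inductive ReachedAtEnd (M : G.Subgraph) : ℕ → SearchState V → Prop where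
  | init : ReachedAtEnd M 0 (initState M)
  | phase (Δ : ℕ) (s t : SearchState V) :
      ReachedAtEnd M Δ s → PhaseCompletes M (Δ + 1) s t → ReachedAtEnd M (Δ + 1) t

/-- In some execution, `Δ` is the breakthrough phase and `s` is the state at its beginning, i.e.,
at the end of phase `Δ - 1`. -/
def IsStateBeforeBreakthrough (M : G.Subgraph) (Δ : ℕ) (s : SearchState V) : Prop :=
  1 ≤ Δ ∧ ReachedAtEnd M (Δ - 1) s ∧ PhaseBreaksThrough M Δ s

/-! ## The contracted graph -/

/-- The conditions under which an edge `uv` of `G` between different blocks is kept, with the two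
ends in a fixed order. -/
def KeepOrdered (M : G.Subgraph) (Δ : ℕ) (s : SearchState V) (u v : V) : Prop :=
  (s.label u = Label.even ∧ s.label v = Label.even ∧ s.lcp u + s.lcp v + 2 = 2 * Δ) ∨
  (s.label u = Label.even ∧ s.label v = Label.odd ∧ ¬ M.Adj u v ∧ s.lcpOdd v = s.lcp u + 1) ∨
  (s.label u = Label.even ∧ s.label v = Label.odd ∧ M.Adj u v ∧ s.lcp u = s.lcpOdd v + 1) ∨
  (s.label u = Label.unlabeled ∧ s.label v = Label.unlabeled ∧ M.Adj u v) ∨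
  (s.label u = Label.even ∧ s.label v = Label.unlabeled ∧ s.lcp u + 2 = Δ)

/-- The graph `H`: its nodes are the blocks of `s.base`, represented by their bases. An edge `uv` of
`G` that satisfies the selection conditions is an edge of `H` with ends `s.base u` and `s.base v`;
we keep its identity as an edge of `G`. -/
def contractedGraph (M : G.Subgraph) (Δ : ℕ) (s : SearchState V) : Graph V (Sym2 V) where
  vertexSet := Set.range s.base
  IsLink e a b := ∃ u v, e = s(u, v) ∧ G.Adj u v ∧ s.base u ≠ s.base v ∧
    (KeepOrdered M Δ s u v ∨ KeepOrdered M Δ s v u) ∧ a = s.base u ∧ b = s.base v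
  isLink_symm := by
    rintro e -
    refine ⟨?_⟩
    rintro a b ⟨u, v, he, hadj, hne, hk, ha, hb⟩
    exact ⟨v, u, he.trans Sym2.eq_swap, hadj.symm, hne.symm, hk.symm, hb, ha⟩
  eq_or_eq_of_isLink_of_isLink := by
    rintro e a b c d ⟨u, v, he, -, -, -, ha, hb⟩ ⟨u', v', he', -, -, -, hc, hd⟩
    rcases Sym2.eq_iff.1 (he.symm.trans he') with ⟨h, -⟩ | ⟨h, -⟩
    · exact Or.inl (by rw [ha, hc, h])
    · exact Or.inr (by rw [ha, hd, h])
  left_mem_of_isLink := by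
    rintro e a b ⟨u, v, -, -, -, -, ha, -⟩
    exact ⟨u, ha.symm⟩

/-- The matching of `H`: the matching edges of `G` that are edges of `H`. -/
def contractedMatching (M : G.Subgraph) (Δ : ℕ) (s : SearchState V) : Set (Sym2 V) :=
  (contractedGraph M Δ s).edgeSet ∩ M.edgeSet

/-- The image of a path of `G` under contraction of the blocks of `s.base`: the edges of the path
that do not run inside a block. -/
def contractedImage (s : SearchState V) {x y : V} (Q : G.Walk x y) : Set (Sym2 V) :=
  {e | e ∈ Q.edges ∧ ¬ (e.map s.base).IsDiag}

end Search

end CardMatching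

/-! The search is a primal-dual method in disguise. With y = `dual Δ s` on vertices, there is a
function `Z` on pairs, which gains 2 at the end of each completed phase for every pair in a common
block, such that y(u) + y(v) + Z(u,v) equals 2 on matching edges and is nonnegative on the other
edges. The steps inside a phase do not change y, and passing from one phase to the next is a dual
adjustment that keeps feasibility (`EndInvariant.feasible_succ`).

Free vertices have y = 1 - Δ. Summing along an augmenting path with 2k + 1 edges therefore gives 2k
= 2(Δ - 1) + `gap Z` + the total slack of the nonmatching edges (`Feasible.length_identity`). The
gap is nonnegative because a matching edge can cross the boundary of a block only at its base. With
Δ = δ + 1 as breakthrough phase, every augmenting path thus has at least 2δ + 1 edges. The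
breakthrough bridge together with two tree paths, all made of tight edges, attains this bound; so
the saps are exactly the augmenting paths with 2δ + 1 edges (`EndInvariant.isShortest_iff`).

The graph H is the contraction of the blocks, restricted to matching edges and tight nonmatching
edges (`Invariant.keep_iff`). An augmenting path of H is lifted by inserting, in each block it
passes, the tight alternating walk to the base; a tight augmenting path has 2δ + 1 edges
(`Invariant.expand`). Conversely, for a sap all inequalities of the duality argument are equalities:
its nonmatching edges between blocks are tight, and it crosses each block boundary at most once by a
matching and at most once by a nonmatching edge. Hence it visits each block in one stretch, and its
image is an alternating simple path of H (`EndInvariant.compress`). -/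

namespace CardMatching

/-! ### Alternating walks and the potential that measures their length. -/

section AlternatingWalks

variable {V : Type*} {G : SimpleGraph V} {M : G.Subgraph}

/-- `Alternates M c d p`: the edges of `p` are alternately in `M` and not in `M`; the first one is
in `M` iff `c = true`, and an edge that continues `p` has to be in `M` iff `d = true`. -/
inductive Alternates (M : G.Subgraph) : Bool → Bool → ∀ {a b : V}, G.Walk a b → Prop
  | nil (c : Bool) (a : V) : Alternates M c c (SimpleGraph.Walk.nil : G.Walk a a)
  | cons {c d : Bool} {a b e : V} (h : G.Adj a b) (p : G.Walk b e)
      (hc : M.Adj a b ↔ c = true) (hp : Alternates M (!c) d p) :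
      Alternates M c d (SimpleGraph.Walk.cons h p)

theorem Alternates.append {c d e : Bool} {a b x : V} {p : G.Walk a b} {q : G.Walk b x}
    (hp : Alternates M c d p) (hq : Alternates M d e q) : Alternates M c e (p.append q) := by
  induction hp with
  | nil => simpa using hq
  | cons h p hc _ ih => exact .cons h _ hc (ih hq)

theorem Alternates.single {c : Bool} {a b : V} (h : G.Adj a b) (hc : M.Adj a b ↔ c = true) :
    Alternates M c (!c) (SimpleGraph.Walk.cons h SimpleGraph.Walk.nil) :=
  .cons h _ hc (.nil _ _)

theorem Alternates.reverse {c d : Bool} {a b : V} {p : G.Walk a b}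
    (hp : Alternates M c d p) : Alternates M (!d) (!c) p.reverse := by
  induction hp with
  | nil => exact .nil _ _
  | @cons c d a b e h p hc _ ih =>
    rw [SimpleGraph.Walk.reverse_cons]
    refine ih.append ?_
    have := Alternates.single (M := M) (c := c) h.symm (by rw [M.adj_comm]; exact hc)
    simpa using this

/-- The number of edges that a tight alternating walk uses up is the loss of potential. -/
def potential (y : V → ℤ) (c : Bool) (a : V) : ℤ := if c = true then y a else 1 - y a

/-- A simple alternating walk whose length is given by the potential of its ends. -/
structure IsTight (M : G.Subgraph) (y : V → ℤ) (c d : Bool) {a b : V} (p : G.Walk a b) :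
    Prop where
  isPath : p.IsPath
  alternates : Alternates M c d p
  length_eq : (p.length : ℤ) = potential y c a - potential y d b

theorem IsTight.nil (y : V → ℤ) (c : Bool) (a : V) :
    IsTight M y c c (SimpleGraph.Walk.nil : G.Walk a a) :=
  ⟨.nil, .nil _ _, by simp⟩

theorem potential_not (y : V → ℤ) (c : Bool) (a : V) :
    potential y (!c) a = 1 - potential y c a := by
  cases c <;> simp [potential]

theorem IsTight.reverse {y : V → ℤ} {c d : Bool} {a b : V} {p : G.Walk a b}
    (hp : IsTight M y c d p) : IsTight M y (!d) (!c) p.reverse :=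
  ⟨hp.isPath.reverse, hp.alternates.reverse, by
    have := hp.length_eq
    rw [SimpleGraph.Walk.length_reverse, potential_not, potential_not]; linarith⟩

/-- The switch between y and 1 - y in `potential` makes a matching edge with y-sum 2 and a
nonmatching edge with y-sum 0 each cost exactly one unit, so the potentials telescope when walks are
concatenated. -/
theorem IsTight.join {y : V → ℤ} {c d e : Bool} {a b b' x : V} {p : G.Walk a b} {q : G.Walk b' x}
    (hp : IsTight M y c d p) (h : G.Adj b b') (hd : M.Adj b b' ↔ d = true)
    (hy : y b + y b' = if d = true then 2 else 0) (hq : IsTight M y (!d) e q)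
    (hdisj : ∀ w ∈ p.support, w ∉ q.support) :
    IsTight M y c e (p.append (SimpleGraph.Walk.cons h q)) := by
  refine ⟨?_, hp.alternates.append (.cons h q hd hq.alternates), ?_⟩
  · rw [SimpleGraph.Walk.isPath_def, SimpleGraph.Walk.support_append]
    simp only [SimpleGraph.Walk.support_cons, List.tail_cons]
    exact List.Nodup.append hp.isPath.support_nodup hq.isPath.support_nodup
      (fun w h1 h2 => hdisj w h1 h2)
  · have h1 := hp.length_eq
    have h2 := hq.length_eq
    rw [SimpleGraph.Walk.length_append, SimpleGraph.Walk.length_cons]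
    push_cast
    rw [h1, h2]
    cases d <;> simp [potential] at * <;> linarith

theorem mem_support_join {a b b' x w : V} {p : G.Walk a b} {q : G.Walk b' x} (h : G.Adj b b') :
    w ∈ (p.append (SimpleGraph.Walk.cons h q)).support ↔ w ∈ p.support ∨ w ∈ q.support := by
  rw [SimpleGraph.Walk.support_append]
  simp

theorem IsTight.congr {y y' : V → ℤ} {c d : Bool} {a b : V} {p : G.Walk a b}
    (hp : IsTight M y c d p) (h : potential y' c a - potential y' d b =
      potential y c a - potential y d b) : IsTight M y' c d p :=
  ⟨hp.isPath, hp.alternates, by rw [h]; exact hp.length_eq⟩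

end AlternatingWalks

/-! ### Dual variables, structural invariants and tree paths. -/

section Invariants

variable {V : Type*} {G : SimpleGraph V} {M : G.Subgraph}

/-- The dual variable of a vertex in phase `Δ`. -/
def dual (Δ : ℕ) (s : SearchState V) (v : V) : ℤ :=
  match s.label v with
  | .even => 1 + s.lcp v - Δ
  | .odd => Δ - s.lcpOdd v
  | .unlabeled => 1

theorem dual_even {Δ : ℕ} {s : SearchState V} {v : V} (h : s.label v = .even) :
    dual Δ s v = 1 + s.lcp v - Δ := by simp [dual, h]

theorem dual_odd {Δ : ℕ} {s : SearchState V} {v : V} (h : s.label v = .odd) :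
    dual Δ s v = Δ - s.lcpOdd v := by simp [dual, h]

theorem dual_unlabeled {Δ : ℕ} {s : SearchState V} {v : V} (h : s.label v = .unlabeled) :
    dual Δ s v = 1 := by simp [dual, h]

/-- The even vertex `u` is a base, and its mate, the odd vertex `v`, is its parent. -/
def IsMatchingTreeEdge (s : SearchState V) (u v : V) : Prop :=
  s.label u = .even ∧ s.label v = .odd ∧ s.base u = u ∧ s.lcp u = s.lcpOdd v + 1

/-- The structure of the search state in phase `Δ`. -/
structure Invariant (M : G.Subgraph) (Δ : ℕ) (s : SearchState V) : Prop where
  base_base : ∀ v, s.base (s.base v) = s.base v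
  label_base : ∀ v, s.label (s.base v) = s.label v
  base_eq : ∀ v, s.label v ≠ .even → s.base v = v
  free : ∀ r, IsFree M r → s.label r = .even ∧ s.lcp r = 0 ∧ s.base r = r
  -- In particular, a matching edge that leaves a block joins two bases.
  mate : ∀ u v, M.Adj u v → (s.label u = .unlabeled ∧ s.label v = .unlabeled) ∨
    (s.label u = .even ∧ s.label v = .even ∧ s.base u = s.base v ∧ s.base u ≠ u ∧ s.base v ≠ v) ∨
    IsMatchingTreeEdge s u v ∨ IsMatchingTreeEdge s v u
  -- The bound by `Δ` ensures that an odd vertex absorbed into a blossom gets an `lcp` of at least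
  -- `Δ`, so that it opens no new growth edge in the same phase.
  odd : ∀ v, s.label v = .odd → s.label (s.par v) = .even ∧ G.Adj (s.par v) v ∧
    ¬ M.Adj (s.par v) v ∧ s.lcpOdd v = s.lcp (s.par v) + 1 ∧ s.lcpOdd v + 1 ≤ Δ ∧ Odd (s.lcpOdd v)
  even_lcp : ∀ v, s.label v = .even → Even (s.lcp v)
  -- For even `v` the length is `lcp v - lcp (base v)`: this is the part of the canonical path
  -- inside the blossom. Other vertices are their own base.
  path : ∀ v, ∃ p : G.Walk v (s.base v), IsTight M (dual Δ s) true true p ∧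
    ∀ w ∈ p.support, s.base w = s.base v

variable {Δ : ℕ} {s : SearchState V}

theorem Invariant.lcp_base_le (hs : Invariant M Δ s) {v : V} (hv : s.label v = .even) :
    s.lcp (s.base v) ≤ s.lcp v := by
  obtain ⟨p, hp, -⟩ := hs.path v
  have h := hp.length_eq
  have hb : s.label (s.base v) = .even := (hs.label_base v).trans hv
  simp only [potential, if_true, dual_even hv, dual_even hb] at h
  omega

/-- A change of phase shifts y equally at both ends of a walk inside a blossom, so tightness
survives. -/
theorem Invariant.mono (hs : Invariant M Δ s) {Δ' : ℕ} (h : Δ ≤ Δ') : Invariant M Δ' s where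
  base_base := hs.base_base
  label_base := hs.label_base
  base_eq := hs.base_eq
  free := hs.free
  mate := hs.mate
  odd v hv := by
    obtain ⟨h1, h2, h3, h4, h5, h6⟩ := hs.odd v hv
    exact ⟨h1, h2, h3, h4, h5.trans h, h6⟩
  even_lcp := hs.even_lcp
  path v := by
    obtain ⟨p, hp, hp'⟩ := hs.path v
    refine ⟨p, hp.congr ?_, hp'⟩
    by_cases hv : s.label v = .even
    · have hb : s.label (s.base v) = .even := (hs.label_base v).trans hv
      simp only [potential, if_true, dual_even hv, dual_even hb]
      ring
    · rw [hs.base_eq v hv]; simp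

theorem Invariant.matching_tree_edge (hs : Invariant M Δ s) {u v : V} (h : M.Adj u v)
    (hu : s.label u = .even) (hb : s.base u = u) : IsMatchingTreeEdge s u v := by
  rcases hs.mate u v h with h1 | h1 | h1 | h1
  · rw [hu] at h1; cases h1.1
  · exact absurd hb h1.2.2.2.1
  · exact h1
  · rw [h1.2.1] at hu; cases hu

/-- The depth of a node in its search structure. -/
def rank (s : SearchState V) (c : V) : ℕ :=
  match s.label c with
  | .even => s.lcp c
  | .odd => s.lcpOdd c
  | .unlabeled => 0

/-- The drop in rank makes ancestry antisymmetric and allows induction towards the root. For an odd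
child, `lcp_base_le` passes from the vertex it was grown from to the base of that vertex. -/
theorem Invariant.parent (hs : Invariant M Δ s) {p c : V} (h : IsParent M s p c) :
    rank s p < rank s c ∧ s.base p = p ∧
      ((s.label c = .odd ∧ s.label p = .even) ∨ (s.label c = .even ∧ s.label p = .odd)) := by
  rcases h with ⟨h1, rfl⟩ | ⟨h1, h2, h3⟩
  · obtain ⟨h4, -, -, h5, -⟩ := hs.odd c h1
    have hb : s.label (s.base (s.par c)) = .even := (hs.label_base _).trans h4
    have := hs.lcp_base_le h4
    refine ⟨?_, hs.base_base _, Or.inl ⟨h1, hb⟩⟩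
    simp only [rank, h1, hb]; omega
  · obtain ⟨-, h5, -, h6⟩ := hs.matching_tree_edge h3 h1 h2
    refine ⟨?_, hs.base_eq p (by rw [h5]; simp), Or.inr ⟨h1, h5⟩⟩
    simp only [rank, h1, h5]; omega

theorem Invariant.ancestor_rank (hs : Invariant M Δ s) {a c : V} (h : IsAncestor M s a c) :
    a = c ∨ rank s a < rank s c := by
  induction h with
  | refl => exact Or.inl rfl
  | tail _ h ih =>
    have := (hs.parent h).1
    rcases ih with rfl | ih
    · exact Or.inr this
    · exact Or.inr (this.trans ih)

theorem Invariant.ancestor_antisymm (hs : Invariant M Δ s) {a c : V} (h : IsAncestor M s a c)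
    (h' : IsAncestor M s c a) : a = c := by
  rcases hs.ancestor_rank h with h1 | h1
  · exact h1
  · rcases hs.ancestor_rank h' with h2 | h2
    · exact h2.symm
    · omega

theorem IsAncestor.trans {a b c : V} (h : IsAncestor M s a b) (h' : IsAncestor M s b c) :
    IsAncestor M s a c := Relation.ReflTransGen.trans h' h

theorem Invariant.not_ancestor_parent (hs : Invariant M Δ s) {p c : V} (h : IsParent M s p c) :
    ¬ IsAncestor M s c p := fun h' => by
  have := (hs.parent h).1
  rcases hs.ancestor_rank h' with h1 | h1
  · subst h1; omega
  · omega

theorem Invariant.ancestor_node (hs : Invariant M Δ s) {a c : V} (h : IsAncestor M s a c)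
    (hc : s.base c = c) (hl : s.label c ≠ .unlabeled) :
    s.base a = a ∧ s.label a ≠ .unlabeled := by
  induction h with
  | refl => exact ⟨hc, hl⟩
  | tail _ h _ =>
    have := hs.parent h
    exact ⟨this.2.1, by rcases this.2.2 with h | h <;> rw [h.2] <;> simp⟩

theorem IsParent.unique (hM : M.IsMatching) {p q c : V} (h : IsParent M s p c)
    (h' : IsParent M s q c) : p = q := by
  rcases h with ⟨h1, h2⟩ | ⟨h1, h2, h3⟩ <;> rcases h' with ⟨h4, h5⟩ | ⟨h4, h5, h6⟩
  · rw [h2, h5]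
  · rw [h1] at h4; cases h4
  · rw [h1] at h4; cases h4
  · exact hM.eq_of_adj_left h3 h6

/-- The ancestors of a node form a chain. -/
theorem ancestor_linear (hM : M.IsMatching) {a b c : V} (h : IsAncestor M s a c)
    (h' : IsAncestor M s b c) : IsAncestor M s a b ∨ IsAncestor M s b a := by
  induction h with
  | refl => exact Or.inr h'
  | @tail a' a h1 h2 ih =>
    rcases ih with ih | ih
    · exact Or.inl (Relation.ReflTransGen.tail ih h2)
    · rcases Relation.ReflTransGen.cases_head ih with rfl | ⟨q, hq, hq'⟩
      · exact Or.inl (Relation.ReflTransGen.single h2)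
      · rw [IsParent.unique hM h2 hq]
        exact Or.inr hq'

/-- The walk along the search structure, from a vertex of a blossom up to an ancestor node. -/
theorem Invariant.tree_path (hs : Invariant M Δ s) {v : V} (hv : s.label v = .even) {a : V}
    (ha : IsAncestor M s a (s.base v)) :
    ∃ p : G.Walk v a, (∀ w ∈ p.support, IsAncestor M s a (s.base w) ∧
        IsAncestor M s (s.base w) (s.base v)) ∧
      ((s.label a = .even ∧ IsTight M (dual Δ s) true true p) ∨
        (s.label a = .odd ∧ IsTight M (dual Δ s) true false p)) := by
  induction ha with
  | refl =>
    obtain ⟨p, hp, hp'⟩ := hs.path v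
    refine ⟨p, fun w hw => ?_, Or.inl ⟨(hs.label_base v).trans hv, hp⟩⟩
    rw [hp' w hw]
    exact ⟨.refl, .refl⟩
  | @tail a' a h1 h2 ih =>
    obtain ⟨p, hp, hp'⟩ := ih
    have hpar := hs.parent h2
    -- The vertices visited so far lie in descendants of the child of `a`, so the block of `a` is
    -- new and the walk stays simple.
    have hdisj : ∀ w ∈ p.support, s.base w ≠ a := fun w hw hwa =>
      hs.not_ancestor_parent h2 (hwa ▸ (hp w hw).1)
    have hup : ∀ w ∈ p.support, IsAncestor M s a (s.base w) ∧
        IsAncestor M s (s.base w) (s.base v) := fun w hw =>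
      ⟨Relation.ReflTransGen.tail (hp w hw).1 h2, (hp w hw).2⟩
    have hav : IsAncestor M s a (s.base v) := Relation.ReflTransGen.tail h1 h2
    rcases h2 with ⟨h3, rfl⟩ | ⟨h3, h4, h5⟩
    · obtain ⟨h6, h7, h8, h9, -, -⟩ := hs.odd a' h3
      obtain ⟨q, hq, hq'⟩ := hs.path (s.par a')
      rcases hp' with hp' | hp'
      · rw [hp'.1] at h3; cases h3
      refine ⟨p.append (.cons h7.symm q), fun w hw => ?_, Or.inl ⟨(hs.label_base _).trans h6, ?_⟩⟩
      · rw [mem_support_join] at hw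
        rcases hw with hw | hw
        · exact hup w hw
        · rw [hq' w hw]; exact ⟨.refl, hav⟩
      · refine hp'.2.join h7.symm ?_ ?_ hq fun w hw hw' => hdisj w hw (hq' w hw')
        · rw [M.adj_comm]; simpa using h8
        · rw [dual_odd h3, dual_even h6]; simp; omega
    · obtain ⟨-, h6, -, h7⟩ := hs.matching_tree_edge h5 h3 h4
      rcases hp' with hp' | hp'
      swap
      · rw [hp'.1] at h3; cases h3
      have hba := hs.base_eq a (by rw [h6]; simp)
      refine ⟨p.append (.cons h5.adj_sub .nil), fun w hw => ?_, Or.inr ⟨h6, ?_⟩⟩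
      · rw [mem_support_join] at hw
        rcases hw with hw | hw
        · exact hup w hw
        · simp only [SimpleGraph.Walk.support_nil, List.mem_singleton] at hw
          rw [hw, hba]
          exact ⟨.refl, hav⟩
      · refine hp'.2.join h5.adj_sub ?_ ?_ (IsTight.nil _ _ _) fun w hw hw' => hdisj w hw ?_
        · simpa using h5
        · rw [dual_odd h6, dual_even h3]; simp; omega
        · simp only [SimpleGraph.Walk.support_nil, List.mem_singleton] at hw'
          rw [hw', hba]

/-- Every search structure has a root. -/
theorem Invariant.exists_root (hs : Invariant M Δ s) {c : V} (hb : s.base c = c)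
    (hl : s.label c ≠ .unlabeled) : ∃ r, IsFree M r ∧ IsAncestor M s r c := by
  induction hn : rank s c using Nat.strong_induction_on generalizing c with
  | _ n ih =>
    subst hn
    by_cases hf : IsFree M c
    · exact ⟨c, hf, .refl⟩
    · have : ∃ p, IsParent M s p c := by
        cases hlc : s.label c with
        | unlabeled => exact absurd hlc hl
        | odd => exact ⟨_, Or.inl ⟨hlc, rfl⟩⟩
        | even =>
          simp only [IsFree, not_forall, not_not] at hf
          obtain ⟨y, hy⟩ := hf
          exact ⟨y, Or.inr ⟨hlc, hb, hy⟩⟩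
      obtain ⟨p, hp⟩ := this
      have hpar := hs.parent hp
      obtain ⟨r, hr, hr'⟩ := ih _ hpar.1 hpar.2.1
        (by rcases hpar.2.2 with h | h <;> rw [h.2] <;> simp) rfl
      exact ⟨r, hr, Relation.ReflTransGen.head hp hr'⟩

end Invariants

/-! ### Growth and blossom steps preserve the invariants and the dual variables. -/

section Steps

variable {V : Type*} {G : SimpleGraph V} {M : G.Subgraph} {Δ : ℕ} {s : SearchState V}

theorem invariant_initState : Invariant M 0 (initState M) where
  base_base _ := rfl
  label_base _ := rfl
  base_eq _ _ := rfl
  free r hr := by simp [initState, hr]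
  mate u v h := by
    left
    have hu : ¬ IsFree M u := fun hf => hf v h
    have hv : ¬ IsFree M v := fun hf => hf u h.symm
    simp [initState, hu, hv]
  odd v hv := by
    simp only [initState] at hv
    split_ifs at hv
  even_lcp v _ := by simp [initState]
  path v := ⟨.nil, IsTight.nil _ _ _, by simp [initState]⟩

/-- The mate of an unlabeled vertex is unlabeled. -/
theorem Invariant.mate_unlabeled (hs : Invariant M Δ s) {v w : V} (hv : s.label v = .unlabeled)
    (h : M.Adj v w) : s.label w = .unlabeled := by
  rcases hs.mate v w h with h1 | h1 | h1 | h1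
  · exact h1.2
  · rw [hv] at h1; cases h1.1
  · have := h1.1; rw [hv] at this; cases this
  · have := h1.2.1; rw [hv] at this; cases this

theorem label_grow_v {u v w : V} (hvw : v ≠ w) : (s.grow u v w).label v = .odd := by
  simp [SearchState.grow, Function.update_of_ne, hvw]

theorem label_grow_w (s : SearchState V) (u v w : V) : (s.grow u v w).label w = .even := by
  simp [SearchState.grow]

theorem label_grow_of_ne {u v w z : V} (hv : z ≠ v) (hw : z ≠ w) :
    (s.grow u v w).label z = s.label z := by
  simp [SearchState.grow, Function.update_of_ne, hv, hw]

/-- The data kept by a step of phase `Δ`: dual variables, and blocks up to union. -/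
structure StepRelation (Δ : ℕ) (s t : SearchState V) : Prop where
  dual_eq : ∀ z, dual Δ t z = dual Δ s z
  base_coarser : ∀ u v, s.base u = s.base v → t.base u = t.base v

theorem StepRelation.refl (Δ : ℕ) (s : SearchState V) : StepRelation Δ s s :=
  ⟨fun _ => rfl, fun _ _ h => h⟩

theorem StepRelation.trans {t r : SearchState V} (h : StepRelation Δ s t)
    (h' : StepRelation Δ t r) : StepRelation Δ s r :=
  ⟨fun z => (h'.dual_eq z).trans (h.dual_eq z), fun u v e => h'.base_coarser _ _
    (h.base_coarser _ _ e)⟩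

/-- Since `lcp u = Δ - 2`, the new odd vertex has y = Δ - (Δ - 1) and its mate y = 1 + Δ - Δ. Both
equal 1, the value of an unlabeled vertex. -/
theorem Invariant.growth_step (hM : M.IsMatching) (hs : Invariant M Δ s) {t : SearchState V}
    (h : IsGrowthStep M Δ s t) : Invariant M Δ t ∧ StepRelation Δ s t := by
  obtain ⟨u, v, w, hu, hlu, huv, hv, hvw, rfl⟩ := h
  have hw := hs.mate_unlabeled hv hvw
  have hne : v ≠ w := hvw.ne
  have hlab : ∀ z, s.label z ≠ .unlabeled → z ≠ v ∧ z ≠ w := fun z hz =>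
    ⟨fun h => hz (h ▸ hv), fun h => hz (h ▸ hw)⟩
  have hbv := hs.base_eq v (by rw [hv]; simp)
  have hbw := hs.base_eq w (by rw [hw]; simp)
  have hl : ∀ z, s.label z ≠ .unlabeled → (s.grow u v w).label z = s.label z := fun z hz =>
    label_grow_of_ne (hlab z hz).1 (hlab z hz).2
  have hlcp : ∀ z, z ≠ w → (s.grow u v w).lcp z = s.lcp z := fun z hz => by
    simp [SearchState.grow, Function.update_of_ne, hz]
  have hlcpw : (s.grow u v w).lcp w = s.lcp u + 2 := by simp [SearchState.grow]
  have hodd : ∀ z, z ≠ v → (s.grow u v w).lcpOdd z = s.lcpOdd z := fun z hz => by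
    simp [SearchState.grow, Function.update_of_ne, hz]
  have hoddv : (s.grow u v w).lcpOdd v = s.lcp u + 1 := by simp [SearchState.grow]
  have hpar : ∀ z, z ≠ v → (s.grow u v w).par z = s.par z := fun z hz => by
    simp [SearchState.grow, Function.update_of_ne, hz]
  have hparv : (s.grow u v w).par v = u := by simp [SearchState.grow]
  have hdual : ∀ z, dual Δ (s.grow u v w) z = dual Δ s z := by
    intro z
    by_cases hzv : z = v
    · subst hzv
      rw [dual_odd (label_grow_v hne), dual_unlabeled hv, hoddv]; omega
    by_cases hzw : z = w
    · subst hzw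
      rw [dual_even (label_grow_w _ _ _ _), dual_unlabeled hw, hlcpw]; omega
    simp only [dual, label_grow_of_ne hzv hzw, hlcp z hzw, hodd z hzv]
  have hue : s.label u ≠ .unlabeled := by rw [hu]; simp
  refine ⟨?_, hdual, fun _ _ h => h⟩
  refine ⟨hs.base_base, fun z => ?_, fun z hz => ?_, fun r hr => ?_, fun a b hab => ?_,
    fun z hz => ?_, fun z hz => ?_, fun z => ?_⟩
  · by_cases hzv : z = v
    · subst hzv; exact congrArg _ hbv
    by_cases hzw : z = w
    · subst hzw; exact congrArg _ hbw
    by_cases hz : s.label z = .even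
    · have hb := (hs.label_base z).trans hz
      exact (hl (s.base z) (by rw [hb]; simp)).trans ((hs.label_base z).trans (hl z (by rw [hz]; simp)).symm)
    · exact congrArg _ (hs.base_eq z hz)
  · by_cases hzv : z = v
    · rw [hzv]; exact hbv
    by_cases hzw : z = w
    · rw [hzw]; exact hbw
    · rw [label_grow_of_ne hzv hzw] at hz
      exact hs.base_eq z hz
  · obtain ⟨h1, h2, h3⟩ := hs.free r hr
    have h4 : s.label r ≠ .unlabeled := by rw [h1]; simp
    exact ⟨(hl r h4).trans h1, (hlcp r (hlab r h4).2).trans h2, h3⟩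
  · have key : ∀ a b, IsMatchingTreeEdge s a b → IsMatchingTreeEdge (s.grow u v w) a b := by
      rintro a b ⟨h1, h2, h3, h4⟩
      have h1' : s.label a ≠ .unlabeled := by rw [h1]; simp
      have h2' : s.label b ≠ .unlabeled := by rw [h2]; simp
      exact ⟨(hl a h1').trans h1, (hl b h2').trans h2, h3, by
        rw [hlcp a (hlab a h1').2, hodd b (hlab b h2').1, h4]⟩
    have hwv : IsMatchingTreeEdge (s.grow u v w) w v :=
      ⟨label_grow_w s u v w, label_grow_v hne, hbw, by rw [hlcpw, hoddv]⟩
    rcases hs.mate a b hab with h1 | h1 | h1 | h1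
    · by_cases hav : a = v
      · subst hav
        have := hM.eq_of_adj_left hab hvw
        subst this
        exact Or.inr (Or.inr (Or.inr hwv))
      by_cases haw : a = w
      · subst haw
        have := hM.eq_of_adj_left hab hvw.symm
        subst this
        exact Or.inr (Or.inr (Or.inl hwv))
      have hbv' : b ≠ v := by
        rintro rfl; exact haw (hM.eq_of_adj_left hab.symm hvw)
      have hbw' : b ≠ w := by
        rintro rfl; exact hav (hM.eq_of_adj_left hab.symm hvw.symm)
      rw [label_grow_of_ne hav haw, label_grow_of_ne hbv' hbw']
      exact Or.inl h1
    · refine Or.inr (Or.inl ⟨?_, ?_, h1.2.2⟩)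
      · rw [hl a (by rw [h1.1]; simp)]; exact h1.1
      · rw [hl b (by rw [h1.2.1]; simp)]; exact h1.2.1
    · exact Or.inr (Or.inr (Or.inl (key a b h1)))
    · exact Or.inr (Or.inr (Or.inr (key b a h1)))
  · by_cases hzv : z = v
    · subst hzv
      rw [hparv, hoddv, hl u hue, hlcp u (hlab u hue).2]
      refine ⟨hu, huv, fun hm => ?_, rfl, by omega, (hs.even_lcp u hu).add_one⟩
      exact (hlab u hue).2 (hM.eq_of_adj_left hm.symm hvw)
    by_cases hzw : z = w
    · subst hzw
      rw [label_grow_w] at hz; cases hz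
    rw [label_grow_of_ne hzv hzw] at hz
    obtain ⟨h1, h2, h3, h4, h5, h6⟩ := hs.odd z hz
    have h1' : s.label (s.par z) ≠ .unlabeled := by rw [h1]; simp
    rw [hpar z hzv, hodd z hzv, hl _ h1', hlcp _ (hlab _ h1').2]
    exact ⟨h1, h2, h3, h4, h5, h6⟩
  · by_cases hzv : z = v
    · subst hzv
      rw [label_grow_v hne] at hz; cases hz
    by_cases hzw : z = w
    · subst hzw
      rw [hlcpw]; exact (hs.even_lcp u hu).add even_two
    rw [label_grow_of_ne hzv hzw] at hz
    rw [hlcp z hzw]; exact hs.even_lcp z hz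
  · obtain ⟨p, hp, hp'⟩ := hs.path z
    refine ⟨p, hp.congr ?_, hp'⟩
    simp only [potential, if_true, hdual]

/-- No edge joins an even vertex with `lcp`-value `Δ - 2` to an unlabeled vertex. -/
def NoGrowthEdge (G : SimpleGraph V) (Δ : ℕ) (s : SearchState V) : Prop :=
  ∀ u v, s.label u = .even → s.label v = .unlabeled → G.Adj u v → s.lcp u + 2 ≠ Δ

theorem Invariant.growth_part (hM : M.IsMatching) (hs : Invariant M Δ s) {t : SearchState V}
    (h : GrowthPart M Δ s t) : Invariant M Δ t ∧ StepRelation Δ s t ∧ NoGrowthEdge G Δ t := by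
  rcases h with ⟨-, h1, h2⟩ | ⟨h1, rfl⟩
  · have : Invariant M Δ t ∧ StepRelation Δ s t := by
      clear h2
      induction h1 with
      | refl => exact ⟨hs, .refl _ _⟩
      | tail _ h ih =>
        have := ih.1.growth_step hM h
        exact ⟨this.1, ih.2.trans this.2⟩
    refine ⟨this.1, this.2, fun u v hu hv huv hl => ?_⟩
    have hv' : ¬ IsFree M v := fun hf => by
      rw [(this.1.free v hf).1] at hv; cases hv
    simp only [IsFree, not_forall, not_not] at hv'
    obtain ⟨w, hw⟩ := hv'
    exact h2 _ ⟨u, v, w, hu, hl, huv, hv, hw, rfl⟩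
  -- For odd `Δ` there is nothing to grow, because even vertices have even `lcp`.
  · refine ⟨hs, .refl _ _, fun u v hu _ _ hl => h1 ?_⟩
    rw [← hl]
    exact (hs.even_lcp u hu).add even_two

/-- The lowest common ancestor of two different blossoms is a blossom. -/
theorem Invariant.lca_even (hM : M.IsMatching) (hs : Invariant M Δ s) {a c b : V}
    (ha : s.label a = .even) (hc : s.label c = .even)
    (hb : IsLowestCommonAncestor M s b a c) : s.label b = .even := by
  obtain ⟨h1, h2, h3⟩ := hb
  -- An odd node has only one child, its mate; if it were a common ancestor of two blossoms, that
  -- child would be a lower one.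
  have key : ∀ {a}, s.label a = .even → IsAncestor M s b a → s.label b = .odd →
      ∃ d, M.Adj d b ∧ IsAncestor M s d a ∧ IsParent M s b d := by
    intro a ha h hb
    rcases Relation.ReflTransGen.cases_tail h with rfl | ⟨d, hd, hd'⟩
    · rw [ha] at hb; cases hb
    rcases hd' with ⟨h4, h5⟩ | ⟨h4, h5, h6⟩
    · rw [h5, hs.label_base, (hs.odd d h4).1] at hb; cases hb
    · exact ⟨d, h6, hd, Or.inr ⟨h4, h5, h6⟩⟩
  cases hlb : s.label b with
  | even => rfl
  | odd =>
    obtain ⟨d, hd, hda, hp⟩ := key ha h1 hlb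
    obtain ⟨d', hd', hdc, -⟩ := key hc h2 hlb
    rw [hM.eq_of_adj_left hd'.symm hd.symm] at hdc
    exact absurd (h3 d hda hdc) (hs.not_ancestor_parent hp)
  | unlabeled =>
    rcases Relation.ReflTransGen.cases_tail h1 with rfl | ⟨d, hd, hd'⟩
    · rw [ha] at hlb; cases hlb
    · rcases (hs.parent hd').2.2 with h | h <;> rw [h.2] at hlb <;> cases hlb

theorem cycleNodes_comm (x y b : V) : cycleNodes M s x y b = cycleNodes M s y x b := by
  ext z; simp only [cycleNodes, Set.mem_ofPred_eq, or_comm]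

/-- The situation in which a blossom is formed. -/
structure BlossomData (M : G.Subgraph) (Δ : ℕ) (s : SearchState V) (x y b : V) : Prop where
  bridge : IsBridge M Δ s x y
  lca : IsLowestCommonAncestor M s b (s.base x) (s.base y)

theorem BlossomData.symm {x y b : V} (h : BlossomData M Δ s x y b) : BlossomData M Δ s y x b := by
  obtain ⟨⟨h1, h2, h3, h4, h5, h6⟩, h7, h8, h9⟩ := h
  exact ⟨⟨h1.symm, fun h => h2 h.symm, h4, h3, h5.symm, by omega⟩, h8, h7,
    fun d h h' => h9 d h' h⟩

/-- The walk from an odd vertex on the cycle through the bridge to the base of the new blossom. -/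
theorem Invariant.around_cycle (hs : Invariant M Δ s) {x y b z : V}
    (h : BlossomData M Δ s x y b) (hlb : s.label b = .even) (hz : s.label z = .odd)
    (hbz : IsAncestor M s b z) (hzx : IsAncestor M s z (s.base x)) :
    ∃ p : G.Walk z b, IsTight M (dual Δ s) true true p ∧
      ∀ w ∈ p.support, s.base w ∈ cycleNodes M s x y b := by
  obtain ⟨⟨h1, h2, h3, h4, h5, h6⟩, h7, h8, h9⟩ := h
  obtain ⟨p, hp, hp'⟩ := hs.tree_path h3 hzx
  obtain ⟨q, hq, hq'⟩ := hs.tree_path h4 h8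
  have hp'' : IsTight M (dual Δ s) true false p := by
    rcases hp' with hp' | hp'
    · rw [hz] at hp'; cases hp'.1
    · exact hp'.2
  have hq'' : IsTight M (dual Δ s) true true q := by
    rcases hq' with hq' | hq'
    · exact hq'.2
    · rw [hlb] at hq'; cases hq'.1
  refine ⟨p.reverse.append (.cons h1 q), ?_, fun w hw => ?_⟩
  · refine hp''.reverse.join h1 (by simpa using h2) ?_ hq'' fun w hw hw' => ?_
    · rw [dual_even h3, dual_even h4]; simp; omega
    · rw [SimpleGraph.Walk.support_reverse, List.mem_reverse] at hw
      -- A node met by both walks is a common ancestor, hence an ancestor of `b`; it is also a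
      -- descendant of `z`. This forces `z = b`, although `z` is odd and `b` even.
      have h10 := h9 _ (hp w hw).2 (hq w hw').2
      have := hs.ancestor_antisymm (hbz) ((hp w hw).1.trans h10)
      rw [this, hz] at hlb; cases hlb
  · rw [mem_support_join, SimpleGraph.Walk.support_reverse, List.mem_reverse] at hw
    rcases hw with hw | hw
    · exact ⟨hbz.trans (hp w hw).1, Or.inl (hp w hw).2⟩
    · exact ⟨(hq w hw).1, Or.inr (hq w hw).2⟩

/-- An even vertex climbs its tree path to `b`. An odd vertex has the wrong parity for that: it
descends to its end of the bridge, crosses it, and climbs to `b` on the other side. -/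
theorem Invariant.cycle_path (hM : M.IsMatching) (hs : Invariant M Δ s) {x y b v : V}
    (h : BlossomData M Δ s x y b) (hv : s.base v ∈ cycleNodes M s x y b) :
    ∃ p : G.Walk v b, IsTight M (dual Δ s) true true p ∧
      ∀ w ∈ p.support, s.base w ∈ cycleNodes M s x y b := by
  have hx := (hs.label_base x).trans h.bridge.2.2.1
  have hy := (hs.label_base y).trans h.bridge.2.2.2.1
  have hlb := hs.lca_even hM hx hy h.lca
  cases hlv : s.label v with
  | even =>
    obtain ⟨p, hp, hp'⟩ := hs.tree_path hlv hv.1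
    refine ⟨p, ?_, fun w hw => ⟨(hp w hw).1, hv.2.imp (hp w hw).2.trans (hp w hw).2.trans⟩⟩
    rcases hp' with hp' | hp'
    · exact hp'.2
    · rw [hlb] at hp'; cases hp'.1
  | odd =>
    have hbv := hs.base_eq v (by rw [hlv]; simp)
    rw [hbv] at hv
    rcases hv.2 with hvx | hvx
    · exact hs.around_cycle h hlb hlv hv.1 hvx
    · rw [cycleNodes_comm]
      exact hs.around_cycle h.symm hlb hlv hv.1 hvx
  | unlabeled =>
    exfalso
    have hl := (hs.label_base v).trans hlv
    rcases hv.2 with hvx | hvx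
    · exact (hs.ancestor_node hvx (hs.base_base _) (by rw [hx]; simp)).2 hl
    · exact (hs.ancestor_node hvx (hs.base_base _) (by rw [hy]; simp)).2 hl

/-- The `lcp` given to an odd vertex of the cycle is what keeps y fixed: as `lcp x + 1 + lcp y = 2Δ
- 1`, the even value 1 + `lcp` - Δ equals the former odd value Δ - `lcpOdd`. -/
theorem Invariant.blossom_step (hM : M.IsMatching) (hs : Invariant M Δ s) {x y b : V}
    (h : BlossomData M Δ s x y b) :
    Invariant M Δ (s.shrink M x y b) ∧ StepRelation Δ s (s.shrink M x y b) ∧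
      (NoGrowthEdge G Δ s → NoGrowthEdge G Δ (s.shrink M x y b)) := by
  have hx := (hs.label_base x).trans h.bridge.2.2.1
  have hy := (hs.label_base y).trans h.bridge.2.2.2.1
  have hxy := h.bridge.2.2.2.2.2
  have hlb := hs.lca_even hM hx hy h.lca
  have hpath := fun v => hs.cycle_path (v := v) hM h
  have hnode : ∀ z ∈ cycleNodes M s x y b, s.base z = z ∧ s.label z ≠ .unlabeled := by
    rintro z ⟨-, hz | hz⟩
    · exact hs.ancestor_node hz (hs.base_base _) (by rw [hx]; simp)
    · exact hs.ancestor_node hz (hs.base_base _) (by rw [hy]; simp)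
  have hbC : b ∈ cycleNodes M s x y b := ⟨.refl, Or.inl h.lca.1⟩
  have hbb := (hnode b hbC).1
  have hparent : ∀ z ∈ cycleNodes M s x y b, z ≠ b → ∀ p, IsParent M s p z →
      p ∈ cycleNodes M s x y b := by
    rintro z ⟨h1, h2⟩ hzb p hp
    rcases Relation.ReflTransGen.cases_head h1 with h3 | ⟨q, hq, hq'⟩
    · exact absurd h3 hzb
    · rw [IsParent.unique hM hp hq]
      have : IsAncestor M s q z := Relation.ReflTransGen.single hq
      exact ⟨hq', h2.imp this.trans this.trans⟩
  -- An odd node on the cycle lies properly above the node of `x` or of `y`, so its only child, its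
  -- mate, is on the cycle too.
  have hchild : ∀ u v, M.Adj u v → IsMatchingTreeEdge s u v → v ∈ cycleNodes M s x y b →
      u ∈ cycleNodes M s x y b := by
    rintro u v huv ⟨h1, h2, h3, -⟩ ⟨h4, h5⟩
    have key : ∀ c, s.label c = .even → IsAncestor M s v c → IsAncestor M s u c := by
      intro c hc hvc
      rcases Relation.ReflTransGen.cases_tail hvc with rfl | ⟨d, hd, hd'⟩
      · rw [hc] at h2; cases h2
      rcases hd' with ⟨h6, h7⟩ | ⟨-, -, h8⟩
      · rw [h7, hs.label_base, (hs.odd d h6).1] at h2; cases h2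
      · rw [hM.eq_of_adj_left huv.symm h8.symm]; exact hd
    exact ⟨Relation.ReflTransGen.head (Or.inr ⟨h1, h3, huv⟩) h4, h5.imp (key _ hx) (key _ hy)⟩
  have hl1 : ∀ z ∈ cycleNodes M s x y b, (s.shrink M x y b).label z = .even := fun z hz => by
    simp [SearchState.shrink, hz]
  have hl2 : ∀ z ∉ cycleNodes M s x y b, (s.shrink M x y b).label z = s.label z := fun z hz => by
    simp [SearchState.shrink, hz]
  have hl3 : ∀ z, s.label z = .even → (s.shrink M x y b).label z = .even := fun z hz => by
    by_cases hz' : z ∈ cycleNodes M s x y b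
    · exact hl1 z hz'
    · rw [hl2 z hz', hz]
  have hl4 : ∀ z, (s.shrink M x y b).label z ≠ .even → z ∉ cycleNodes M s x y b ∧
      (s.shrink M x y b).label z = s.label z := fun z hz => by
    have : z ∉ cycleNodes M s x y b := fun h => hz (hl1 z h)
    exact ⟨this, hl2 z this⟩
  have hlcp1 : ∀ z, z ∈ cycleNodes M s x y b → s.label z = .odd →
      (s.shrink M x y b).lcp z = s.lcp x + 1 + s.lcp y - s.lcpOdd z := fun z hz hz' => by
    simp [SearchState.shrink, hz, hz']
  have hlcp2 : ∀ z, s.label z = .even → (s.shrink M x y b).lcp z = s.lcp z := fun z hz => by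
    simp [SearchState.shrink, hz]
  have hb1 : ∀ z, s.base z ∈ cycleNodes M s x y b → (s.shrink M x y b).base z = b := fun z hz => by
    simp [SearchState.shrink, hz]
  have hb2 : ∀ z, s.base z ∉ cycleNodes M s x y b → (s.shrink M x y b).base z = s.base z :=
    fun z hz => by simp [SearchState.shrink, hz]
  have hdual : ∀ z, dual Δ (s.shrink M x y b) z = dual Δ s z := by
    intro z
    by_cases hz : z ∈ cycleNodes M s x y b
    · cases hz' : s.label z with
      | even => rw [dual_even (hl1 z hz), dual_even hz', hlcp2 z hz']
      | odd =>
        have := (hs.odd z hz').2.2.2.2.1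
        rw [dual_even (hl1 z hz), dual_odd hz', hlcp1 z hz hz']
        omega
      | unlabeled => exact absurd hz' (hnode z hz).2
    · have h1 : (s.shrink M x y b).lcp z = s.lcp z := by simp [SearchState.shrink, hz]
      simp only [dual, hl2 z hz, h1]
      rfl
  have hcoarse : ∀ u v, s.base u = s.base v →
      (s.shrink M x y b).base u = (s.shrink M x y b).base v := fun u v huv => by
    by_cases hu : s.base u ∈ cycleNodes M s x y b
    · rw [hb1 u hu, hb1 v (huv ▸ hu)]
    · rw [hb2 u hu, hb2 v (huv ▸ hu), huv]
  have hbeq : ∀ z, (s.shrink M x y b).label z ≠ .even → s.base z = z ∧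
      (s.shrink M x y b).base z = z := fun z hz => by
    obtain ⟨h1, h2⟩ := hl4 z hz
    have h3 := hs.base_eq z (h2 ▸ hz)
    exact ⟨h3, by rw [hb2 z (by rw [h3]; exact h1), h3]⟩
  have heven : ∀ z, s.base z ∈ cycleNodes M s x y b → (s.shrink M x y b).label z = .even := by
    intro z hz
    by_contra hz'
    exact hz' (hl1 z (by rw [← (hbeq z hz').1]; exact hz))
  refine ⟨⟨fun z => ?_, fun z => ?_, fun z hz => (hbeq z hz).2, fun r hr => ?_, fun u v huv => ?_,
    fun z hz => ?_, fun z hz => ?_, fun z => ?_⟩, ⟨hdual, hcoarse⟩, fun hng u v hu hv huv => ?_⟩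
  · by_cases hz : s.base z ∈ cycleNodes M s x y b
    · rw [hb1 z hz, hb1 b (by rw [hbb]; exact hbC)]
    · rw [hb2 z hz, hb2 (s.base z) (by rw [hs.base_base]; exact hz), hs.base_base]
  · by_cases hz : s.base z ∈ cycleNodes M s x y b
    · rw [hb1 z hz, hl1 b hbC, heven z hz]
    · rw [hb2 z hz, hl2 _ hz, hs.label_base]
      by_cases hz' : s.label z = .even
      · rw [hl3 z hz', hz']
      · rw [hs.base_eq z hz'] at hz
        rw [hl2 z hz]
  · obtain ⟨h1, h2, h3⟩ := hs.free r hr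
    refine ⟨hl3 r h1, (hlcp2 r h1).trans h2, ?_⟩
    by_cases hz : r ∈ cycleNodes M s x y b
    · rw [hb1 r (by rw [h3]; exact hz)]
      rcases Relation.ReflTransGen.cases_head hz.1 with h4 | ⟨q, ⟨h4, -⟩ | ⟨-, -, h4⟩, -⟩
      · exact h4.symm
      · rw [h1] at h4; cases h4
      · exact absurd h4 (hr q)
    · rw [hb2 r (by rw [h3]; exact hz), h3]
  · have key : ∀ u v, M.Adj u v → IsMatchingTreeEdge s u v →
        ((s.shrink M x y b).label u = .even ∧ (s.shrink M x y b).label v = .even ∧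
          (s.shrink M x y b).base u = (s.shrink M x y b).base v ∧
          (s.shrink M x y b).base u ≠ u ∧ (s.shrink M x y b).base v ≠ v) ∨
        IsMatchingTreeEdge (s.shrink M x y b) u v := by
      intro u v huv he
      have hpar : IsParent M s v u := Or.inr ⟨he.1, he.2.2.1, huv⟩
      have hvb := hs.base_eq v (by rw [he.2.1]; simp)
      by_cases hv : v ∈ cycleNodes M s x y b
      · have hu := hchild u v huv he hv
        left
        have hub : b ≠ u := by
          rintro rfl; exact hs.not_ancestor_parent hpar hv.1
        have hvb' : b ≠ v := by
          intro h; rw [h, he.2.1] at hlb; cases hlb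
        have e1 := hb1 u (by rw [he.2.2.1]; exact hu)
        have e2 := hb1 v (by rw [hvb]; exact hv)
        rw [e1, e2]
        exact ⟨hl1 u hu, hl1 v hv, rfl, hub, hvb'⟩
      · right
        -- With its parent `v` off the cycle, `u` can be on the cycle only as `b`.
        have e : (s.shrink M x y b).base u = u := by
          by_cases hu : u ∈ cycleNodes M s x y b
          · rw [hb1 u (by rw [he.2.2.1]; exact hu)]
            by_contra hne
            exact hv (hparent u hu (fun h => hne h.symm) v hpar)
          · rw [hb2 u (by rw [he.2.2.1]; exact hu), he.2.2.1]
        exact ⟨hl3 u he.1, (hl2 v hv).trans he.2.1, e, (hlcp2 u he.1).trans he.2.2.2⟩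
    rcases hs.mate u v huv with h1 | h1 | h1 | h1
    · left
      rw [hl2 u fun h => (hnode u h).2 h1.1, hl2 v fun h => (hnode v h).2 h1.2]
      exact h1
    · right; left
      refine ⟨hl3 u h1.1, hl3 v h1.2.1, hcoarse u v h1.2.2.1, ?_, ?_⟩
      · by_cases hu : s.base u ∈ cycleNodes M s x y b
        · rw [hb1 u hu]; rintro rfl; exact h1.2.2.2.1 hbb
        · rw [hb2 u hu]; exact h1.2.2.2.1
      · by_cases hu : s.base v ∈ cycleNodes M s x y b
        · rw [hb1 v hu]; rintro rfl; exact h1.2.2.2.2 hbb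
        · rw [hb2 v hu]; exact h1.2.2.2.2
    · exact Or.inr ((key u v huv h1).imp_right Or.inl)
    · rcases key v u huv.symm h1 with h2 | h2
      · exact Or.inr (Or.inl ⟨h2.2.1, h2.1, h2.2.2.1.symm, h2.2.2.2.2, h2.2.2.2.1⟩)
      · exact Or.inr (Or.inr (Or.inr h2))
  · obtain ⟨h0, h0'⟩ := hl4 z (by rw [hz]; simp)
    obtain ⟨h1, h2, h3, h4, h5, h6⟩ := hs.odd z (h0' ▸ hz)
    exact ⟨hl3 _ h1, h2, h3, h4.trans (congrArg (· + 1) (hlcp2 _ h1).symm), h5, h6⟩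
  · by_cases hz' : s.label z = .even
    · rw [hlcp2 z hz']; exact hs.even_lcp z hz'
    · have hzC : z ∈ cycleNodes M s x y b := by
        by_contra h; exact hz' ((hl2 z h) ▸ hz)
      cases hz'' : s.label z with
      | even => exact absurd hz'' hz'
      | odd =>
        obtain ⟨-, -, -, -, h5, h6⟩ := hs.odd z hz''
        rw [hlcp1 z hzC hz'']
        obtain ⟨k, hk⟩ := h6
        -- The new `lcp` is (2Δ - 1) - (2k + 1).
        exact ⟨Δ - 1 - k, by omega⟩
      | unlabeled => exact absurd hz'' (hnode z hzC).2
  · by_cases hz : s.base z ∈ cycleNodes M s x y b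
    · obtain ⟨p, hp, hp'⟩ := hpath z hz
      rw [hb1 z hz]
      exact ⟨p, hp.congr (by simp only [potential, if_true, hdual]), fun w hw => hb1 w (hp' w hw)⟩
    · obtain ⟨p, hp, hp'⟩ := hs.path z
      rw [hb2 z hz]
      refine ⟨p, hp.congr (by simp only [potential, if_true, hdual]), fun w hw => ?_⟩
      rw [hb2 w (by rw [hp' w hw]; exact hz), hp' w hw]
  · obtain ⟨h1, h2⟩ := hl4 v (by rw [hv]; simp)
    rw [h2] at hv
    by_cases hu' : s.label u = .even
    · rw [hlcp2 u hu']; exact hng u v hu' hv huv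
    · have huC : u ∈ cycleNodes M s x y b := by
        by_contra h; exact hu' ((hl2 u h) ▸ hu)
      cases hu'' : s.label u with
      | even => exact absurd hu'' hu'
      | odd =>
        -- A newly even vertex has `lcp` equal to 2Δ - 1 - `lcpOdd`, which is at least Δ and so too
        -- large for growth.
        have := (hs.odd u hu'').2.2.2.2.1
        rw [hlcp1 u huC hu'']
        omega
      | unlabeled => exact absurd hu'' (hnode u huC).2

theorem Invariant.blossom_steps (hM : M.IsMatching) (hs : Invariant M Δ s) {t : SearchState V}
    (h : Relation.ReflTransGen (IsBlossomStep M Δ) s t) :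
    Invariant M Δ t ∧ StepRelation Δ s t ∧ (NoGrowthEdge G Δ s → NoGrowthEdge G Δ t) := by
  induction h with
  | refl => exact ⟨hs, .refl _ _, id⟩
  | tail _ h ih =>
    obtain ⟨x, y, b, h1, -, h2, rfl⟩ := h
    have := ih.1.blossom_step hM ⟨h1, h2⟩
    exact ⟨this.1, ih.2.1.trans this.2.1, fun h => this.2.2 (ih.2.2 h)⟩

end Steps

/-! ### Linear programming duality and the length of augmenting paths. -/

section Duality

variable {V : Type*} {G : SimpleGraph V} {M : G.Subgraph} {Δ : ℕ} {s : SearchState V}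

/-- The vertices `p 0, …, p (2 * k + 1)` form an augmenting path. -/
structure IsAugmentingSequence (M : G.Subgraph) (k : ℕ) (p : ℕ → V) : Prop where
  inj : Set.InjOn p {i | i ≤ 2 * k + 1}
  adj : ∀ i ≤ 2 * k, G.Adj (p i) (p (i + 1))
  mem : ∀ i ≤ 2 * k, M.Adj (p i) (p (i + 1)) ↔ Odd i
  free_left : IsFree M (p 0)
  free_right : IsFree M (p (2 * k + 1))

/-- Sum of `Z` over the matching edges minus the sum over the other edges. -/
def gap (Z : V → V → ℤ) (k : ℕ) (p : ℕ → V) : ℤ :=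
  ∑ i ∈ Finset.range k, Z (p (2 * i + 1)) (p (2 * i + 2)) -
    ∑ i ∈ Finset.range (k + 1), Z (p (2 * i)) (p (2 * i + 1))

open Classical in
/-- Indicator of membership in a block. -/
noncomputable def inBlock (f : V → V) (b v : V) : ℤ := if f v = b then 1 else 0

open Classical in
/-- Indicator of being in the same block. -/
noncomputable def sameBlock (f : V → V) (u v : V) : ℤ := if f u = f v then 1 else 0

/-- The nonmatching edges of an augmenting path cover all its vertices, the matching edges all but
the two ends. -/
theorem sum_pairs (g : ℕ → ℤ) (k : ℕ) :
    ∑ i ∈ Finset.range (k + 1), (g (2 * i) + g (2 * i + 1)) =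
      g 0 + g (2 * k + 1) + ∑ i ∈ Finset.range k, (g (2 * i + 1) + g (2 * i + 2)) := by
  induction k with
  | zero => simp
  | succ k ih =>
    rw [Finset.sum_range_succ, ih, Finset.sum_range_succ]
    simp only [show 2 * (k + 1) = 2 * k + 2 by ring]
    ring

theorem sum_indicator_le_one [DecidableEq V] (p : ℕ → V) (n : ℕ) (h : Set.InjOn p {i | i ≤ n})
    (b : V) : ∑ i ∈ Finset.range (n + 1), (if p i = b then 1 else 0 : ℤ) ≤ 1 := by
  rw [← Finset.sum_filter, Finset.sum_const, nsmul_eq_mul, mul_one]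
  norm_cast
  rw [Finset.card_le_one]
  intro i hi j hj
  simp only [Finset.mem_filter, Finset.mem_range] at hi hj
  exact h (show i ≤ n by omega) (show j ≤ n by omega) (hi.2.trans hj.2.symm)

/-- Number of crossings of the boundary of a block, by even positions. -/
noncomputable def evenCrossings (f : V → V) (k : ℕ) (p : ℕ → V) (b : V) : ℤ :=
  ∑ i ∈ Finset.range (k + 1), (inBlock f b (p (2 * i)) - inBlock f b (p (2 * i + 1))) ^ 2

/-- Number of crossings of the boundary of a block, by odd positions. -/
noncomputable def oddCrossings (f : V → V) (k : ℕ) (p : ℕ → V) (b : V) : ℤ :=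
  ∑ i ∈ Finset.range k, (inBlock f b (p (2 * i + 1)) - inBlock f b (p (2 * i + 2))) ^ 2

theorem inBlock_mul_self (f : V → V) (b v : V) : inBlock f b v * inBlock f b v = inBlock f b v := by
  unfold inBlock; split_ifs <;> simp

theorem inBlock_nonneg (f : V → V) (b v : V) : 0 ≤ inBlock f b v := by
  unfold inBlock; split_ifs <;> simp

/-- For an indicator χ, (χ(u) - χ(v))² = χ(u) + χ(v) - 2χ(u)χ(v). Summing over each of the two
pairings in `sum_pairs` and subtracting cancels the inner vertices. -/
theorem crossings_identity (f : V → V) (k : ℕ) (p : ℕ → V) (b : V) :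
    2 * gap (fun u v => inBlock f b u * inBlock f b v) k p =
      evenCrossings f k p b - (oddCrossings f k p b + inBlock f b (p 0) +
        inBlock f b (p (2 * k + 1))) := by
  have h := sum_pairs (fun i => inBlock f b (p i)) k
  have key : ∀ u v, (inBlock f b u - inBlock f b v) ^ 2 =
      inBlock f b u + inBlock f b v - 2 * (inBlock f b u * inBlock f b v) := fun u v => by
    linear_combination inBlock_mul_self f b u + inBlock_mul_self f b v
  simp only [gap, evenCrossings, oddCrossings, key, Finset.sum_sub_distrib, ← Finset.mul_sum]
  linarith

/-- Non-base vertices are matched inside their block. So a matching edge crossing the boundary of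
block `b`, or a free end in that block, uses the vertex `b` itself, which occurs at most once on the
path. -/
theorem odd_crossings_le (hM : M.IsMatching) {f : V → V}
    (hf : ∀ v, f v ≠ v → ∃ w, M.Adj v w ∧ f w = f v)
    {k : ℕ} {p : ℕ → V} (hp : IsAugmentingSequence M k p) (b : V) :
    oddCrossings f k p b + inBlock f b (p 0) + inBlock f b (p (2 * k + 1)) ≤ 1 := by
  classical
  have hfree : ∀ v, IsFree M v → inBlock f b v ≤ if v = b then 1 else 0 := by
    intro v hv
    have : f v = v := by
      by_contra h
      obtain ⟨w, hw, -⟩ := hf v h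
      exact hv w hw
    simp [inBlock, this]
  have hcross : ∀ u v, M.Adj u v → (inBlock f b u - inBlock f b v) ^ 2 ≤
      (if u = b then 1 else 0) + (if v = b then 1 else 0) := by
    have hbase : ∀ u v, M.Adj u v → f u ≠ f v → f u = u := by
      intro u v huv h
      by_contra h'
      obtain ⟨w, hw, hw'⟩ := hf u h'
      rw [hM.eq_of_adj_left hw huv] at hw'
      exact h hw'.symm
    intro u v huv
    by_cases h : f u = f v
    · simp only [inBlock, h, sub_self]
      split_ifs <;> simp
    · have hu := hbase u v huv h
      have hv := hbase v u huv.symm (Ne.symm h)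
      simp only [inBlock, hu, hv]
      split_ifs <;> simp
  refine le_trans ?_ (sum_indicator_le_one p (2 * k + 1) hp.inj b)
  have h1 := sum_pairs (fun i => if p i = b then 1 else 0) k
  have h2 : ∀ n (g : ℕ → ℤ), ∑ i ∈ Finset.range (2 * n), g i =
      ∑ i ∈ Finset.range n, (g (2 * i) + g (2 * i + 1)) := by
    intro n g
    induction n with
    | zero => simp
    | succ n ih => rw [Nat.mul_succ, Finset.sum_range_succ, Finset.sum_range_succ, ih,
        Finset.sum_range_succ]; ring
  rw [show 2 * k + 1 + 1 = 2 * (k + 1) by ring, h2, h1]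
  have h3 := hfree _ hp.free_left
  have h4 := hfree _ hp.free_right
  have h5 : oddCrossings f k p b ≤ ∑ i ∈ Finset.range k,
      ((if p (2 * i + 1) = b then 1 else 0) + (if p (2 * i + 2) = b then 1 else 0)) := by
    refine Finset.sum_le_sum fun i hi => hcross _ _ ?_
    rw [Finset.mem_range] at hi
    exact (hp.mem (2 * i + 1) (by omega)).2 (odd_two_mul_add_one i)
  linarith

theorem evenCrossings_nonneg (f : V → V) (k : ℕ) (p : ℕ → V) (b : V) :
    0 ≤ evenCrossings f k p b := Finset.sum_nonneg fun _ _ => sq_nonneg _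

/-- The identity and the bound give only that twice the gap is at least -1; integrality does the
rest. -/
theorem gap_block_nonneg (hM : M.IsMatching) {f : V → V}
    (hf : ∀ v, f v ≠ v → ∃ w, M.Adj v w ∧ f w = f v)
    {k : ℕ} {p : ℕ → V} (hp : IsAugmentingSequence M k p) (b : V) :
    0 ≤ gap (fun u v => inBlock f b u * inBlock f b v) k p := by
  have h1 := crossings_identity f k p b
  have h2 := odd_crossings_le hM hf hp b
  have h3 := evenCrossings_nonneg f k p b
  omega

theorem gap_sameBlock [Fintype V] (f : V → V) (k : ℕ) (p : ℕ → V) :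
    gap (sameBlock f) k p = ∑ b, gap (fun u v => inBlock f b u * inBlock f b v) k p := by
  have h : ∀ u v, sameBlock f u v = ∑ b, inBlock f b u * inBlock f b v := by
    intro u v
    classical
    simp [sameBlock, inBlock, eq_comm]
  simp only [gap, Finset.sum_sub_distrib, h]
  congr 1 <;> exact Finset.sum_comm

/-- `Z` gives values to the pairs of vertices in common blossoms that, with the dual variables of
the vertices, are feasible for the linear program of the matching problem. -/
structure Feasible (M : G.Subgraph) (Δ : ℕ) (s : SearchState V) (Z : V → V → ℤ) : Prop where
  nonneg : ∀ u v, 0 ≤ Z u v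
  diff : ∀ u v, s.base u ≠ s.base v → Z u v = 0
  nonmatching : ∀ u v, G.Adj u v → ¬ M.Adj u v → 0 ≤ dual Δ s u + dual Δ s v + Z u v
  matching : ∀ u v, M.Adj u v → dual Δ s u + dual Δ s v + Z u v = 2
  -- Carrying this as a property of `Z` makes it unnecessary to remember the blocks of earlier
  -- phases.
  gap_nonneg : ∀ k p, IsAugmentingSequence M k p → 0 ≤ gap Z k p

theorem Feasible.step {t : SearchState V} {Z : V → V → ℤ} (h : Feasible M Δ s Z)
    (hst : StepRelation Δ s t) : Feasible M Δ t Z where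
  nonneg := h.nonneg
  diff u v huv := h.diff u v fun h' => huv (hst.base_coarser u v h')
  nonmatching u v := by rw [hst.dual_eq, hst.dual_eq]; exact h.nonmatching u v
  matching u v := by rw [hst.dual_eq, hst.dual_eq]; exact h.matching u v
  gap_nonneg := h.gap_nonneg

/-- The properties of the state at the end of phase `Δ`. -/
structure EndInvariant (M : G.Subgraph) (Δ : ℕ) (s : SearchState V) : Prop where
  invariant : Invariant M Δ s
  no_growth : NoGrowthEdge G Δ s
  no_bridge : ∀ x y, ¬ IsBridge M Δ s x y
  feasible : ∃ Z, Feasible M Δ s Z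

theorem Invariant.exists_mate (hs : Invariant M Δ s) {v : V} (hv : s.base v ≠ v) :
    ∃ w, M.Adj v w ∧ s.base w = s.base v := by
  have hf : ¬ IsFree M v := fun h => hv (hs.free v h).2.2
  simp only [IsFree, not_forall, not_not] at hf
  obtain ⟨w, hw⟩ := hf
  refine ⟨w, hw, ?_⟩
  rcases hs.mate v w hw with h | h | h | h
  · exact absurd (hs.base_eq v (by rw [h.1]; simp)) hv
  · exact h.2.2.1.symm
  · exact absurd h.2.2.1 hv
  · exact absurd (hs.base_eq v (by rw [h.2.1]; simp)) hv

/-- The change of the dual variables from one phase to the next. -/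
theorem dual_succ (s : SearchState V) (v : V) :
    dual (Δ + 1) s v = dual Δ s v +
      match s.label v with | .even => -1 | .odd => 1 | .unlabeled => 0 := by
  cases h : s.label v
  · rw [dual_unlabeled h, dual_unlabeled h]; simp
  · rw [dual_odd h, dual_odd h]; push_cast; ring
  · rw [dual_even h, dual_even h]; push_cast; ring

/-- The dual adjustment at the end of a phase. -/
theorem EndInvariant.feasible_succ [Finite V] (hM : M.IsMatching) (hs : EndInvariant M Δ s) :
    ∃ Z, Feasible M Δ s Z ∧
      Feasible M (Δ + 1) s (fun u v => Z u v + 2 * sameBlock s.base u v) := by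
  obtain ⟨Z, hZ⟩ := hs.feasible
  have hI := hs.invariant
  have hsame : ∀ u v, 0 ≤ sameBlock s.base u v := fun u v => by
    unfold sameBlock; split_ifs <;> simp
  have hself : ∀ u v, s.base u = s.base v → sameBlock s.base u v = 1 := fun u v h => by
    simp [sameBlock, h]
  have hdiff : ∀ u v, s.base u ≠ s.base v → sameBlock s.base u v = 0 := fun u v h => by
    simp [sameBlock, h]
  refine ⟨Z, hZ, fun u v => ?_, fun u v h => ?_, fun u v hadj hm => ?_, fun u v hm => ?_,
    fun k p hp => ?_⟩
  · have := hZ.nonneg u v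
    have := hsame u v
    linarith
  · simp [hZ.diff u v h, hdiff u v h]
  · have h0 := hZ.nonmatching u v hadj hm
    have h1 := hsame u v
    -- The slack of such an edge drops by 1 in the adjustment. It is an integer, and it is not 0
    -- since no growth edge is left.
    have heu : ∀ u v, s.label u = .even → s.label v = .unlabeled → G.Adj u v →
        0 ≤ dual Δ s u + dual Δ s v + Z u v → 1 ≤ dual Δ s u + dual Δ s v + Z u v := by
      intro u v hu hv huv h0
      have h2 := hs.no_growth u v hu hv huv
      have h3 : s.base u ≠ s.base v := fun h => by
        have h4 := hI.label_base u
        rw [h, hI.label_base, hu, hv] at h4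
        cases h4
      rw [hZ.diff u v h3, dual_even hu, dual_unlabeled hv] at h0 ⊢
      omega
    rw [dual_succ, dual_succ]
    cases hu : s.label u <;> cases hv : s.label v <;> dsimp only
    · linarith
    · linarith
    · have hZ' : Z u v = Z v u := by
        have h3 : s.base u ≠ s.base v := fun h => by
          have h4 := hI.label_base u
          rw [h, hI.label_base, hu, hv] at h4
          cases h4
        rw [hZ.diff u v h3, hZ.diff v u h3.symm]
      have := heu v u hv hu hadj.symm (by linarith)
      linarith
    · linarith
    · linarith
    · linarith
    · have := heu u v hu hv hadj h0
      linarith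
    · linarith
    -- Two even vertices lose 2 together. Inside a blossom `Z` gains 2 in return; between blossoms
    -- the slack is even, as all `lcp` are, and nonzero for lack of bridges, hence at least 2.
    · by_cases hb : s.base u = s.base v
      · rw [hself u v hb]; linarith
      · have h2 := hs.no_bridge u v
        have h3 : s.lcp u + s.lcp v + 2 ≠ 2 * Δ := fun h => h2 ⟨hadj, hm, hu, hv, hb, h⟩
        obtain ⟨a, ha⟩ := hI.even_lcp u hu
        obtain ⟨c, hc⟩ := hI.even_lcp v hv
        rw [hZ.diff u v hb, dual_even hu, dual_even hv] at h0 ⊢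
        rw [hdiff u v hb]
        omega
  · have h0 := hZ.matching u v hm
    rw [dual_succ, dual_succ]
    have key : s.label u = .unlabeled ∧ s.label v = .unlabeled ∨
        s.label u = .even ∧ s.label v = .even ∧ s.base u = s.base v ∨
        s.label u = .even ∧ s.label v = .odd ∨ s.label u = .odd ∧ s.label v = .even := by
      rcases hI.mate u v hm with h | h | h | h
      · exact Or.inl h
      · exact Or.inr (Or.inl ⟨h.1, h.2.1, h.2.2.1⟩)
      · exact Or.inr (Or.inr (Or.inl ⟨h.1, h.2.1⟩))
      · exact Or.inr (Or.inr (Or.inr ⟨h.2.1, h.1⟩))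
    have hne : s.label u ≠ s.label v → s.base u ≠ s.base v := fun h h' => h (by
      rw [← hI.label_base u, h', hI.label_base])
    rcases key with ⟨hu, hv⟩ | ⟨hu, hv, h⟩ | ⟨hu, hv⟩ | ⟨hu, hv⟩
    · have h3 : s.base u ≠ s.base v := by
        rw [hI.base_eq u (by rw [hu]; simp), hI.base_eq v (by rw [hv]; simp)]
        exact hm.ne
      rw [hu, hv, hdiff u v h3]; dsimp only; linarith
    · rw [hu, hv, hself u v h]; dsimp only; linarith
    · rw [hdiff u v (hne (by rw [hu, hv]; simp)), hu, hv]; dsimp only; linarith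
    · rw [hdiff u v (hne (by rw [hu, hv]; simp)), hu, hv]; dsimp only; linarith
  · have h1 := hZ.gap_nonneg k p hp
    have h2 : 0 ≤ gap (sameBlock s.base) k p := by
      have := Fintype.ofFinite V
      rw [gap_sameBlock]
      exact Finset.sum_nonneg fun b _ => gap_block_nonneg hM (fun v => hI.exists_mate) hp b
    have h3 : gap (fun u v => Z u v + 2 * sameBlock s.base u v) k p =
        gap Z k p + 2 * gap (sameBlock s.base) k p := by
      simp only [gap, Finset.sum_add_distrib, ← Finset.mul_sum]
      ring
    rw [h3]
    linarith

theorem ReachedAtEnd.endInvariant [Finite V] (hM : M.IsMatching) (h : ReachedAtEnd M Δ s) :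
    EndInvariant M Δ s := by
  induction h with
  | init =>
    refine ⟨invariant_initState, fun u v _ _ _ => by omega, fun x y h => ?_, fun _ _ => 0, ?_⟩
    · have := h.2.2.2.2.2
      omega
    -- In phase 0 all y are 1, so `Z = 0` is feasible.
    · have hd : ∀ v, dual 0 (initState M) v = 1 := fun v => by
        unfold dual initState
        dsimp only
        by_cases h : IsFree M v <;> simp [h]
      refine ⟨fun _ _ => le_rfl, fun _ _ _ => rfl, fun u v _ _ => ?_, fun u v _ => ?_,
        fun k p _ => by simp [gap]⟩
      · rw [hd, hd]; norm_num
      · rw [hd, hd]; norm_num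
  | phase Δ s t _ h ih =>
    obtain ⟨s', h1, h2, h3⟩ := h
    obtain ⟨Z, -, hZ⟩ := ih.feasible_succ hM
    obtain ⟨h4, h5, h6⟩ := (ih.invariant.mono (Nat.le_succ Δ)).growth_part hM h1
    obtain ⟨h7, h8, h9⟩ := h4.blossom_steps hM h2
    exact ⟨h7, h9 h6, h3, _, (hZ.step h5).step h8⟩

/-- The slack of the edges of an augmenting path determines its length. -/
theorem Feasible.length_identity {Z : V → V → ℤ} (hs : Invariant M Δ s) (h : Feasible M Δ s Z)
    {k : ℕ} {p : ℕ → V} (hp : IsAugmentingSequence M k p) :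
    (2 * k : ℤ) = 2 * (Δ - 1) + gap Z k p + ∑ i ∈ Finset.range (k + 1),
      (dual Δ s (p (2 * i)) + dual Δ s (p (2 * i + 1)) + Z (p (2 * i)) (p (2 * i + 1))) := by
  -- The `k` matching edges contribute 2 each; comparing with the nonmatching edges leaves the two
  -- free ends, each with y = 1 - Δ, and the gap of `Z`.
  have h1 := sum_pairs (fun i => dual Δ s (p i)) k
  have h2 : ∑ i ∈ Finset.range k, (dual Δ s (p (2 * i + 1)) + dual Δ s (p (2 * i + 2)) +
      Z (p (2 * i + 1)) (p (2 * i + 2))) = 2 * k := by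
    rw [Finset.sum_congr rfl (g := fun _ => (2 : ℤ)), Finset.sum_const, Finset.card_range,
      nsmul_eq_mul, mul_comm]
    intro i hi
    rw [Finset.mem_range] at hi
    exact h.matching _ _ ((hp.mem (2 * i + 1) (by omega)).2 (odd_two_mul_add_one i))
  have h3 : ∀ r, IsFree M r → dual Δ s r = 1 - Δ := fun r hr => by
    obtain ⟨h4, h5, -⟩ := hs.free r hr
    rw [dual_even h4, h5]; simp
  have h4 := h3 _ hp.free_left
  have h5 := h3 _ hp.free_right
  simp only [gap]
  rw [Finset.sum_add_distrib] at h2 ⊢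
  linarith

theorem IsAugmentingSequence.nonmatching {k : ℕ} {p : ℕ → V} (hp : IsAugmentingSequence M k p)
    {i : ℕ} (hi : i ≤ k) : ¬ M.Adj (p (2 * i)) (p (2 * i + 1)) := fun h => by
  have := (hp.mem (2 * i) (by omega)).1 h
  exact (Nat.not_odd_iff_even.2 (even_two_mul i)) this

/-- An augmenting path that exists when phase `Δ + 1` begins has at least `2 * Δ + 1` edges. -/
theorem EndInvariant.le_length [Finite V] (hM : M.IsMatching) (hs : EndInvariant M Δ s) {k : ℕ}
    {p : ℕ → V} (hp : IsAugmentingSequence M k p) : Δ ≤ k := by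
  -- The adjusted duals of phase Δ + 1 are already feasible, which raises the bound on `k` from Δ -
  -- 1 to Δ.
  obtain ⟨Z, -, hZ⟩ := hs.feasible_succ hM
  have h1 := hZ.length_identity (hs.invariant.mono (Nat.le_succ Δ)) hp
  have h2 := hZ.gap_nonneg k p hp
  have h3 := Finset.sum_nonneg fun i (hi : i ∈ Finset.range (k + 1)) =>
    hZ.nonmatching _ _ (hp.adj (2 * i) (by rw [Finset.mem_range] at hi; omega))
      (hp.nonmatching (i := i) (by rw [Finset.mem_range] at hi; omega))
  push_cast at h1
  linarith

/-- If it has that many edges, its nonmatching edges are tight, and it crosses the boundary of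
each block at most twice: by at most one matching edge and at most one other edge. -/
theorem EndInvariant.shortest [Finite V] (hM : M.IsMatching) (hs : EndInvariant M Δ s)
    {p : ℕ → V} (hp : IsAugmentingSequence M Δ p) :
    (∀ i ≤ Δ, s.base (p (2 * i)) ≠ s.base (p (2 * i + 1)) →
      dual (Δ + 1) s (p (2 * i)) + dual (Δ + 1) s (p (2 * i + 1)) = 0) ∧
    ∀ b, evenCrossings s.base Δ p b = oddCrossings s.base Δ p b + inBlock s.base b (p 0) +
        inBlock s.base b (p (2 * Δ + 1)) ∧ evenCrossings s.base Δ p b ≤ 1 := by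
  have := Fintype.ofFinite V
  obtain ⟨Z, hZ0, hZ⟩ := hs.feasible_succ hM
  have h1 := hZ.length_identity (hs.invariant.mono (Nat.le_succ Δ)) hp
  have hblock := fun b => gap_block_nonneg hM (fun v => hs.invariant.exists_mate (v := v)) hp b
  have h2 : gap (fun u v => Z u v + 2 * sameBlock s.base u v) Δ p =
      gap Z Δ p + 2 * gap (sameBlock s.base) Δ p := by
    simp only [gap, Finset.sum_add_distrib, ← Finset.mul_sum]
    ring
  have h3 := hZ0.gap_nonneg Δ p hp
  have h4 : 0 ≤ gap (sameBlock s.base) Δ p := by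
    rw [gap_sameBlock]; exact Finset.sum_nonneg fun b _ => hblock b
  have hterm : ∀ i ∈ Finset.range (Δ + 1), 0 ≤ dual (Δ + 1) s (p (2 * i)) +
      dual (Δ + 1) s (p (2 * i + 1)) + (Z (p (2 * i)) (p (2 * i + 1)) +
        2 * sameBlock s.base (p (2 * i)) (p (2 * i + 1))) := fun i hi =>
    hZ.nonmatching _ _ (hp.adj (2 * i) (by rw [Finset.mem_range] at hi; omega))
      (hp.nonmatching (i := i) (by rw [Finset.mem_range] at hi; omega))
  have h5 := Finset.sum_nonneg hterm
  push_cast at h1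
  rw [h2] at h1
  -- The length identity with `k = Δ` says that nonnegative quantities sum to zero: every slack, and
  -- the gap of every block, vanishes.
  have h6 := (Finset.sum_eq_zero_iff_of_nonneg hterm).1 (by linarith)
  have h7 : gap (sameBlock s.base) Δ p = 0 := by linarith
  rw [gap_sameBlock] at h7
  have h8 := (Finset.sum_eq_zero_iff_of_nonneg fun b _ => hblock b).1 h7
  refine ⟨fun i hi hne => ?_, fun b => ?_⟩
  · have h9 := h6 i (Finset.mem_range.2 (by omega))
    have h10 := hZ.diff _ _ hne
    linarith
  · have h9 := crossings_identity s.base Δ p b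
    rw [h8 b (Finset.mem_univ b)] at h9
    have h10 := odd_crossings_le hM (fun v => hs.invariant.exists_mate (v := v)) hp b
    exact ⟨by linarith, by linarith⟩

end Duality

/-! ### Augmenting paths as walks, and the length of a sap. -/

section AugmentingWalks

variable {V : Type*} {G : SimpleGraph V} {M : G.Subgraph}

theorem Alternates.isChain {c d : Bool} {a b : V} {p : G.Walk a b} (hp : Alternates M c d p) :
    List.IsChain (fun e e' => e ∈ M.edgeSet ↔ e' ∉ M.edgeSet) p.edges := by
  induction hp with
  | nil => simp
  | @cons c d a b e h p hc hp ih =>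
    cases hp with
    | nil => simp
    | cons h' p' hc' hp' =>
      simp only [SimpleGraph.Walk.edges_cons, List.isChain_cons_cons] at ih ⊢
      refine ⟨?_, ih⟩
      simp only [SimpleGraph.Subgraph.mem_edgeSet, hc, hc']
      cases c <;> simp

theorem exists_alternates {a b : V} (p : G.Walk a b) (c : Bool)
    (h : List.IsChain (fun e e' => e ∈ M.edgeSet ↔ e' ∉ M.edgeSet) p.edges)
    (hc : ∀ e ∈ p.edges.head?, e ∈ M.edgeSet ↔ c = true) : ∃ d, Alternates M c d p := by
  induction p generalizing c with
  | nil => exact ⟨c, .nil _ _⟩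
  | @cons u v w huv p ih =>
    have h1 : M.Adj u v ↔ c = true := by simpa using hc
    rw [SimpleGraph.Walk.edges_cons, List.isChain_cons] at h
    obtain ⟨d, hd⟩ := ih (!c) h.2 fun e he => by
      have h2 := h.1 e he
      rw [SimpleGraph.Subgraph.mem_edgeSet, h1] at h2
      cases c <;> simp_all
    exact ⟨d, .cons huv p h1 hd⟩

theorem Alternates.eq_false {c d : Bool} {a b : V} {p : G.Walk a b} (hp : Alternates M c d p)
    (hl : 0 < p.length) (ha : IsFree M a) : c = false := by
  cases hp with
  | nil => simp at hl
  | @cons _ _ _ b' _ h p hc hp =>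
    have := ha b'
    cases c <;> simp_all

/-- No matching edge is incident to a free vertex, so the two outer edges are nonmatching and the
parities at both ends are determined. -/
theorem isAugmentingPath_iff {x y : V} {Q : G.Walk x y} : IsAugmentingPath M Q ↔
    Q.IsPath ∧ IsFree M x ∧ IsFree M y ∧ Alternates M false true Q := by
  constructor
  · rintro ⟨h1, h2, h3, h4, h5⟩
    refine ⟨h1, h3, h4, ?_⟩
    obtain ⟨d, hd⟩ := exists_alternates Q false h5 (by
      cases Q with
      | nil => simp
      | cons h p => simpa using h3 _)
    have h6 := hd.reverse.eq_false (by simpa using h2) h4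
    have : d = true := by simpa using h6
    exact this ▸ hd
  · rintro ⟨h1, h3, h4, h5⟩
    refine ⟨h1, ?_, h3, h4, h5.isChain⟩
    cases h5
    simp

theorem Alternates.length_parity {c d : Bool} {a b : V} {p : G.Walk a b}
    (hp : Alternates M c d p) : Even p.length ↔ c = d := by
  induction hp with
  | nil => simp
  | @cons c d a b e h p hc hp ih =>
    rw [SimpleGraph.Walk.length_cons, Nat.even_add_one, ih]
    cases c <;> cases d <;> simp

theorem Alternates.getVert {c d : Bool} {a b : V} {p : G.Walk a b} (hp : Alternates M c d p)
    {i : ℕ} (hi : i < p.length) :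
    M.Adj (p.getVert i) (p.getVert (i + 1)) ↔ (Even i ↔ c = true) := by
  induction hp generalizing i with
  | nil => simp at hi
  | @cons c d a b e h p hc hp ih =>
    cases i with
    | zero => simpa using hc
    | succ i =>
      rw [SimpleGraph.Walk.length_cons] at hi
      rw [SimpleGraph.Walk.getVert_cons_succ, SimpleGraph.Walk.getVert_cons_succ,
        ih (by omega), Nat.even_add_one]
      cases c <;> simp

theorem IsAugmentingPath.sequence {x y : V} {Q : G.Walk x y} (h : IsAugmentingPath M Q) :
    ∃ k, Q.length = 2 * k + 1 ∧ IsAugmentingSequence M k Q.getVert := by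
  obtain ⟨h1, h2, h3, h4⟩ := isAugmentingPath_iff.1 h
  have h5 : Odd Q.length := by
    rw [← Nat.not_even_iff_odd, h4.length_parity]; simp
  obtain ⟨k, hk⟩ := h5
  refine ⟨k, hk, ?_, fun i hi => Q.adj_getVert_succ (by omega), fun i hi => ?_, ?_, ?_⟩
  · rw [← hk]; exact h1.getVert_injOn
  · rw [h4.getVert (by omega), ← Nat.not_even_iff_odd]; simp
  · rw [Q.getVert_zero]; exact h2
  · rw [← hk, Q.getVert_length]; exact h3

variable {Δ : ℕ} {s : SearchState V}

theorem Invariant.dual_free (hs : Invariant M Δ s) (Δ' : ℕ) {r : V} (hr : IsFree M r) :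
    dual Δ' s r = 1 - Δ' := by
  obtain ⟨h4, h5, -⟩ := hs.free r hr
  rw [dual_even h4, h5]; simp

/-- A tight walk between free vertices is an augmenting path. -/
theorem Invariant.augmenting_of_tight (hs : Invariant M Δ s) {x y : V} {Q : G.Walk x y} {Δ' : ℕ}
    (hx : IsFree M x) (hy : IsFree M y) (hQ : IsTight M (dual (Δ' + 1) s) false true Q) :
    IsAugmentingPath M Q ∧ Q.length = 2 * Δ' + 1 := by
  refine ⟨isAugmentingPath_iff.2 ⟨hQ.isPath, hx, hy, hQ.alternates⟩, ?_⟩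
  have h := hQ.length_eq
  simp only [potential, hs.dual_free _ hx, hs.dual_free _ hy] at h
  simp at h
  omega

/-- Duality gives the lower bound. It is attained by the breakthrough bridge extended by the tree
paths from its ends to their roots, which is tight for the duals of phase Δ + 1. -/
theorem EndInvariant.isShortest_iff [Finite V] (hM : M.IsMatching) (hs : EndInvariant M Δ s)
    (hb : PhaseBreaksThrough M (Δ + 1) s) {x y : V} {Q : G.Walk x y} :
    IsShortestAugmentingPath M Q ↔ IsAugmentingPath M Q ∧ Q.length = 2 * Δ + 1 := by
  have hle : ∀ (x y : V) (Q : G.Walk x y), IsAugmentingPath M Q → 2 * Δ + 1 ≤ Q.length := by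
    intro x y Q hQ
    obtain ⟨k, hk, hQ'⟩ := hQ.sequence
    have := hs.le_length hM hQ'
    omega
  have hex : ∃ (x y : V) (Q : G.Walk x y), IsAugmentingPath M Q ∧ Q.length = 2 * Δ + 1 := by
    obtain ⟨s', t, x, y, h1, h2, ⟨h3, h4, h5, h6, -, h8⟩, h9⟩ := hb
    obtain ⟨hI', -, -⟩ := (hs.invariant.mono (Nat.le_succ Δ)).growth_part hM h1
    obtain ⟨hI, -, -⟩ := hI'.blossom_steps hM h2
    have hroot : ∀ x, t.label x = .even → ∃ r, IsFree M r ∧ IsAncestor M t r (t.base x) ∧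
        ∃ p : G.Walk x r, IsTight M (dual (Δ + 1) t) true true p ∧
          ∀ w ∈ p.support, IsAncestor M t r (t.base w) := by
      intro x hx
      obtain ⟨r, hr, hr'⟩ := hI.exists_root (hI.base_base x) (by rw [hI.label_base, hx]; simp)
      obtain ⟨p, hp, hp'⟩ := hI.tree_path hx hr'
      refine ⟨r, hr, hr', p, ?_, fun w hw => (hp w hw).1⟩
      rcases hp' with hp' | hp'
      · exact hp'.2
      · rw [(hI.free r hr).1] at hp'; cases hp'.1
    obtain ⟨r, hr, hrx, p, hp, hp'⟩ := hroot x h5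
    obtain ⟨r', hr', hry, q, hq, hq'⟩ := hroot y h6
    have htop : ∀ r a, IsFree M r → IsAncestor M t a r → a = r := by
      intro r a hr ha
      rcases Relation.ReflTransGen.cases_head ha with h | ⟨d, ⟨h, -⟩ | ⟨-, -, h⟩, -⟩
      · exact h.symm
      · rw [(hI.free r hr).1] at h; cases h
      · exact absurd h (hr d)
    refine ⟨r, r', p.reverse.append (.cons h3 q), hI.augmenting_of_tight hr hr' ?_⟩
    refine hp.reverse.join h3 (by simpa using h4) ?_ hq fun w hw hw' => h9 ?_
    · rw [dual_even h5, dual_even h6]; simp; omega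
    · rw [SimpleGraph.Walk.support_reverse, List.mem_reverse] at hw
      -- The ancestors of a node form a chain and a root has no proper ancestor, so a shared vertex
      -- would put both ends of the bridge in one tree.
      have : r = r' := by
        rcases ancestor_linear hM (hp' w hw) (hq' w hw') with h | h
        · exact htop r' r hr' h
        · exact (htop r r' hr h).symm
      exact ⟨r, hr, hrx, this ▸ hry⟩
  constructor
  · rintro ⟨h1, h2⟩
    obtain ⟨x', y', Q', h3, h4⟩ := hex
    refine ⟨h1, le_antisymm (h4 ▸ h2 x' y' Q' h3) (hle _ _ _ h1)⟩
  · rintro ⟨h1, h2⟩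
    exact ⟨h1, fun x' y' Q' h => h2 ▸ hle _ _ _ h⟩

end AugmentingWalks

/-! ### The contracted graph in terms of tight edges. -/

section Contraction

variable {V : Type*} {G : SimpleGraph V} {M : G.Subgraph} {Δ : ℕ} {s : SearchState V}

/-- A matching edge between different blocks is tight, and it joins two bases. -/
theorem Invariant.matching_between_blocks (hs : Invariant M Δ s) (Δ' : ℕ) {u v : V}
    (h : M.Adj u v) (hne : s.base u ≠ s.base v) :
    dual Δ' s u + dual Δ' s v = 2 ∧ s.base u = u ∧ s.base v = v := by
  rcases hs.mate u v h with h | h | h | h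
  · rw [dual_unlabeled h.1, dual_unlabeled h.2]
    exact ⟨by norm_num, hs.base_eq u (by rw [h.1]; simp), hs.base_eq v (by rw [h.2]; simp)⟩
  · exact absurd h.2.2.1 hne
  · rw [dual_even h.1, dual_odd h.2.1, h.2.2.2]
    exact ⟨by push_cast; ring, h.2.2.1, hs.base_eq v (by rw [h.2.1]; simp)⟩
  · rw [dual_even h.1, dual_odd h.2.1, h.2.2.2]
    exact ⟨by push_cast; ring, hs.base_eq u (by rw [h.2.1]; simp), h.2.2.1⟩

/-- The contracted graph consists of the tight edges between different blocks. -/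
theorem Invariant.keep_iff (hs : Invariant M Δ s) {u v : V} (hne : s.base u ≠ s.base v) :
    (KeepOrdered M (Δ + 1) s u v ∨ KeepOrdered M (Δ + 1) s v u) ↔
      (M.Adj u v ∨ dual (Δ + 1) s u + dual (Δ + 1) s v = 0) := by
  constructor
  · have key : ∀ u v, KeepOrdered M (Δ + 1) s u v →
        M.Adj u v ∨ dual (Δ + 1) s u + dual (Δ + 1) s v = 0 := by
      rintro u v (⟨h1, h2, h3⟩ | ⟨h1, h2, -, h3⟩ | ⟨-, -, h, -⟩ | ⟨-, -, h⟩ | ⟨h1, h2, h3⟩)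
      · right; rw [dual_even h1, dual_even h2]; push_cast; omega
      · right; rw [dual_even h1, dual_odd h2]; push_cast; omega
      · exact Or.inl h
      · exact Or.inl h
      · right; rw [dual_even h1, dual_unlabeled h2]; push_cast; omega
    rintro (h | h)
    · exact key u v h
    · rw [M.adj_comm, add_comm]; exact key v u h
  · intro h
    by_cases hm : M.Adj u v
    · rcases hs.mate u v hm with h | h | h | h
      · exact Or.inl (Or.inr (Or.inr (Or.inr (Or.inl ⟨h.1, h.2, hm⟩))))
      · exact absurd h.2.2.1 hne
      · exact Or.inl (Or.inr (Or.inr (Or.inl ⟨h.1, h.2.1, hm, h.2.2.2⟩)))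
      · exact Or.inr (Or.inr (Or.inr (Or.inl ⟨h.1, h.2.1, hm.symm, h.2.2.2⟩)))
    · have h0 := h.resolve_left hm
      have hm' : ¬ M.Adj v u := fun h => hm h.symm
      -- Odd vertices have y at least 2 and unlabeled ones y = 1, so a nonmatching edge with y-sum 0
      -- must have an even end.
      have hodd : ∀ v, s.label v = .odd → 2 ≤ dual (Δ + 1) s v := fun v hv => by
        have := (hs.odd v hv).2.2.2.2.1
        rw [dual_odd hv]; push_cast; omega
      cases hu : s.label u <;> cases hv : s.label v
      · rw [dual_unlabeled hu, dual_unlabeled hv] at h0; omega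
      · rw [dual_unlabeled hu] at h0
        have := hodd v hv
        omega
      · rw [dual_unlabeled hu, dual_even hv] at h0
        exact Or.inr (Or.inr (Or.inr (Or.inr (Or.inr ⟨hv, hu, by push_cast at h0; omega⟩))))
      · rw [dual_unlabeled hv] at h0
        have := hodd u hu
        omega
      · have := hodd u hu
        have := hodd v hv
        omega
      · rw [dual_odd hu, dual_even hv] at h0
        exact Or.inr (Or.inr (Or.inl ⟨hv, hu, hm', by push_cast at h0; omega⟩))
      · rw [dual_even hu, dual_unlabeled hv] at h0
        exact Or.inl (Or.inr (Or.inr (Or.inr (Or.inr ⟨hu, hv, by push_cast at h0; omega⟩))))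
      · rw [dual_even hu, dual_odd hv] at h0
        exact Or.inl (Or.inr (Or.inl ⟨hu, hv, hm, by push_cast at h0; omega⟩))
      · rw [dual_even hu, dual_even hv] at h0
        exact Or.inl (Or.inl ⟨hu, hv, by push_cast at h0; omega⟩)

theorem Invariant.isLink_iff (hs : Invariant M Δ s) {e : Sym2 V} {a b : V} :
    (contractedGraph M (Δ + 1) s).IsLink e a b ↔ ∃ u v, e = s(u, v) ∧ G.Adj u v ∧
      s.base u ≠ s.base v ∧ (M.Adj u v ∨ dual (Δ + 1) s u + dual (Δ + 1) s v = 0) ∧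
      a = s.base u ∧ b = s.base v := by
  constructor
  · rintro ⟨u, v, h1, h2, h3, h4, h5⟩
    exact ⟨u, v, h1, h2, h3, (hs.keep_iff h3).1 h4, h5⟩
  · rintro ⟨u, v, h1, h2, h3, h4, h5⟩
    exact ⟨u, v, h1, h2, h3, (hs.keep_iff h3).2 h4, h5⟩

theorem mem_contractedMatching {e : Sym2 V} {a b : V}
    (h : (contractedGraph M Δ s).IsLink e a b) :
    e ∈ contractedMatching M Δ s ↔ e ∈ M.edgeSet :=
  ⟨fun h => h.2, fun h' => ⟨h.edge_mem, h'⟩⟩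

/-- The free nodes of the contracted graph are those of the free vertices. -/
theorem Invariant.isFreeIn_iff (hs : Invariant M Δ s) {r : V} :
    IsFreeIn (contractedGraph M (Δ + 1) s) (contractedMatching M (Δ + 1) s) r ↔ IsFree M r := by
  constructor
  · rintro ⟨⟨v, hv⟩, h⟩ w hw
    have hr : s.base r = r := by rw [← hv, hs.base_base]
    -- The mate of a base lies outside the block of that base, so its matching edge survives in the
    -- contraction.
    have hne : s.base r ≠ s.base w := by
      intro h'
      rcases hs.mate r w hw with h | h | h | h
      · rw [hr, hs.base_eq w (by rw [h.2]; simp)] at h'; exact hw.ne h'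
      · exact h.2.2.2.1 hr
      · rw [hr, hs.base_eq w (by rw [h.2.1]; simp)] at h'; exact hw.ne h'
      · rw [hr, h.2.2.1] at h'; exact hw.ne h'
    have hl : (contractedGraph M (Δ + 1) s).IsLink s(r, w) (s.base r) (s.base w) :=
      hs.isLink_iff.2 ⟨r, w, rfl, hw.adj_sub, hne, Or.inl hw, rfl, rfl⟩
    refine h s(r, w) ((mem_contractedMatching hl).2 hw) ?_
    rw [hr] at hl
    exact hl.inc_left
  · intro hr
    refine ⟨⟨r, (hs.free r hr).2.2⟩, ?_⟩
    rintro e ⟨-, he⟩ ⟨b, hb⟩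
    obtain ⟨u, v, rfl, -, h1, -, h2, -⟩ := hs.isLink_iff.1 hb
    have := hs.matching_between_blocks 0 he h1
    rw [h2, this.2.1] at hr
    exact hr v he

theorem isDiag_of_support {a b c : V} (f : V → V) (p : G.Walk a b)
    (h : ∀ w ∈ p.support, f w = c) : ∀ e ∈ p.edges, (e.map f).IsDiag := by
  intro e he
  induction e with
  | _ u v =>
    rw [Sym2.map_mk, Sym2.mk_isDiag_iff, h u (p.fst_mem_support_of_mem_edges he),
      h v (p.snd_mem_support_of_mem_edges he)]

/-- The walk inside a block, from the vertex where an alternating walk enters to the vertex where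
it leaves. -/
theorem Invariant.traverse (hs : Invariant M Δ s) {c : Bool} {u v : V} (h : s.base u = s.base v)
    (hc : if c = true then s.base v = v else s.base u = u) :
    ∃ p : G.Walk u v, IsTight M (dual Δ s) c c p ∧ ∀ w ∈ p.support, s.base w = s.base u := by
  cases c with
  | true =>
    have hv : s.base u = v := h.trans (by simpa using hc)
    subst hv
    exact hs.path u
  | false =>
    obtain ⟨p, hp, hp'⟩ := hs.path v
    have hu : s.base v = u := h.symm.trans (by simpa using hc)
    subst hu
    refine ⟨p.reverse, hp.reverse, fun w hw => ?_⟩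
    rw [SimpleGraph.Walk.support_reverse, List.mem_reverse] at hw
    rw [hp' w hw, h]

end Contraction

/-! ### From augmenting paths of the contracted graph to saps. -/

section Expansion

variable {V : Type*} {G : SimpleGraph V} {M : G.Subgraph} {Δ : ℕ} {s : SearchState V}

/-- An augmenting path of the contracted graph extends to a tight augmenting path. -/
theorem Invariant.expand (hs : Invariant M (Δ + 1) s) (hs' : Invariant M Δ s) {P : Set (Sym2 V)}
    (hP : FormsAugmentingPath (contractedGraph M (Δ + 1) s) (contractedMatching M (Δ + 1) s) P) :
    ∃ (x y : V) (Q : G.Walk x y), IsAugmentingPath M Q ∧ Q.length = 2 * Δ + 1 ∧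
      P = contractedImage s Q := by
  obtain ⟨k, x, e, hinj, hlink, halt, hx0, hx1, rfl⟩ := hP
  rw [hs'.isFreeIn_iff] at hx0 hx1
  have hN : ∀ i, e i ∈ contractedMatching M (Δ + 1) s ↔ e i ∈ M.edgeSet := fun i =>
    mem_contractedMatching (hlink i)
  simp only [hN] at halt
  simp only [hs'.isLink_iff] at hlink
  choose u v he hadj hne htight hu hv using hlink
  have hmem : ∀ i, e i ∈ M.edgeSet ↔ M.Adj (u i) (v i) := fun i => by
    rw [he, SimpleGraph.Subgraph.mem_edgeSet]
  have hbu : ∀ i, M.Adj (u i) (v i) → s.base (u i) = u i := fun i h =>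
    (hs.matching_between_blocks 0 h (hne i)).2.1
  have hbv : ∀ i, M.Adj (u i) (v i) → s.base (v i) = v i := fun i h =>
    (hs.matching_between_blocks 0 h (hne i)).2.2
  have hdual : ∀ i (c : Bool), (M.Adj (u i) (v i) ↔ c = true) →
      dual (Δ + 1) s (u i) + dual (Δ + 1) s (v i) = if c = true then 2 else 0 := by
    intro i c hc
    by_cases h : M.Adj (u i) (v i)
    · rw [if_pos (hc.1 h)]
      exact (hs.matching_between_blocks _ h (hne i)).1
    · rw [if_neg fun h' => h (hc.2 h')]
      exact (htight i).resolve_left h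
  have hx0b := (hs.free _ hx0).2.2
  have hx1b := (hs.free _ hx1).2.2
  have hdiag : ∀ i, ¬ ((e i).map s.base).IsDiag := fun i => by
    rw [he, Sym2.map_mk, Sym2.mk_isDiag_iff]; exact hne i
  -- The walk stops where `e j` leaves its node, and `c` records whether `e j` is a matching edge.
  have hmain : ∀ j : Fin (k + 1), ∃ c : Bool, (M.Adj (u j) (v j) ↔ c = true) ∧
      ∃ W : G.Walk (x 0) (u j), IsTight M (dual (Δ + 1) s) false c W ∧
        (∀ w ∈ W.support, ∃ i ≤ j, s.base w = x i.castSucc) ∧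
        ∀ ε, (ε ∈ W.edges ∧ ¬ (ε.map s.base).IsDiag) ↔ ∃ i < j, ε = e i := by
    intro j
    induction j using Fin.induction with
    | zero =>
      have h1 : s.base (x 0) = s.base (u 0) := hx0b.trans (hu 0)
      have h2 : ¬ M.Adj (u 0) (v 0) := fun h => by
        have := hbu 0 h
        rw [← h1, hx0b] at this
        exact hx0 (v 0) (this ▸ h)
      obtain ⟨p, hp, hp'⟩ := hs.traverse (c := false) h1 (by simpa using hx0b)
      refine ⟨false, by simpa using h2, p, hp, fun w hw => ⟨0, le_rfl, ?_⟩, fun ε => ?_⟩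
      · rw [hp' w hw, hx0b]; rfl
      · constructor
        · rintro ⟨h3, h4⟩
          exact absurd (isDiag_of_support s.base p hp' ε h3) h4
        · rintro ⟨i, hi, -⟩
          exact absurd hi (Fin.not_lt_zero i)
    | succ j ih =>
      obtain ⟨c, hc, W, hW, hW1, hW2⟩ := ih
      have h1 : s.base (v j.castSucc) = s.base (u j.succ) := by
        rw [← hv, ← hu, Fin.succ_castSucc]
      have hc' : M.Adj (u j.succ) (v j.succ) ↔ (!c) = true := by
        have := halt j
        rw [hmem, hmem, hc] at this
        cases c <;> simp_all
      -- One of the two consecutive edges at this node is a matching edge and ends in the base; the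
      -- walk to the base is used forwards or backwards accordingly.
      obtain ⟨p, hp, hp'⟩ := hs.traverse (c := !c) h1 (by
        cases c with
        | true => simpa using hbv _ (hc.2 rfl)
        | false => simpa using hbu _ (hc'.2 rfl))
      have hp'' : ∀ w ∈ p.support, s.base w = x j.succ.castSucc := fun w hw => by
        rw [hp' w hw, ← hv, Fin.succ_castSucc]
      refine ⟨!c, hc', W.append (.cons (hadj j.castSucc) p), ?_, fun w hw => ?_, fun ε => ?_⟩
      · refine hW.join (hadj _) hc (hdual _ c hc) hp fun w hw hw' => ?_
        obtain ⟨i, hi, hi'⟩ := hW1 w hw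
        have h2 := hinj (hi'.symm.trans (hp'' w hw'))
        rw [Fin.castSucc_inj] at h2
        rw [h2] at hi
        exact absurd hi (not_le.2 Fin.castSucc_lt_succ)
      · rw [mem_support_join] at hw
        rcases hw with hw | hw
        · obtain ⟨i, hi, hi'⟩ := hW1 w hw
          exact ⟨i, hi.trans Fin.castSucc_lt_succ.le, hi'⟩
        · exact ⟨j.succ, le_rfl, hp'' w hw⟩
      · rw [SimpleGraph.Walk.edges_append, SimpleGraph.Walk.edges_cons, List.mem_append,
          List.mem_cons]
        constructor
        · rintro ⟨h2 | h2 | h2, h3⟩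
          · obtain ⟨i, hi, hi'⟩ := (hW2 ε).1 ⟨h2, h3⟩
            exact ⟨i, hi.trans Fin.castSucc_lt_succ, hi'⟩
          · exact ⟨j.castSucc, Fin.castSucc_lt_succ, by rw [h2, he]⟩
          · exact absurd (isDiag_of_support s.base p hp'' ε h2) h3
        · rintro ⟨i, hi, rfl⟩
          rcases (Fin.le_castSucc_iff.2 hi).lt_or_eq with h2 | rfl
          · obtain ⟨h3, h4⟩ := (hW2 _).2 ⟨i, h2, rfl⟩
            exact ⟨Or.inl h3, h4⟩
          · exact ⟨Or.inr (Or.inl (he _)), hdiag _⟩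
  obtain ⟨c, hc, W, hW, hW1, hW2⟩ := hmain (Fin.last k)
  have h1 : s.base (v (Fin.last k)) = x (Fin.last (k + 1)) := by rw [← hv, Fin.succ_last]
  have h2 : ¬ M.Adj (u (Fin.last k)) (v (Fin.last k)) := fun h => by
    have := hbv _ h
    rw [h1] at this
    exact hx1 _ (this ▸ h.symm)
  have hcf : c = false := by simpa using hc.not.1 h2
  subst hcf
  -- The base of the last node is the free vertex itself, so the walk to the base completes the
  -- path.
  have hpath := hs.path (v (Fin.last k))
  rw [h1] at hpath
  obtain ⟨p, hp, hp'⟩ := hpath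
  have hdisj : ∀ w ∈ W.support, w ∉ p.support := fun w hw hw' => by
    obtain ⟨i, -, hi⟩ := hW1 w hw
    have := hinj (hi.symm.trans (hp' w hw'))
    exact (Fin.castSucc_lt_last i).ne this
  have hQ := hW.join (hadj _) hc (hdual _ _ hc) hp hdisj
  obtain ⟨h3, h4⟩ := hs.augmenting_of_tight hx0 hx1 hQ
  refine ⟨_, _, _, h3, h4, ?_⟩
  ext ε
  simp only [contractedImage, Set.mem_range, Set.mem_ofPred_eq, SimpleGraph.Walk.edges_append,
    SimpleGraph.Walk.edges_cons, List.mem_append, List.mem_cons]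
  constructor
  · rintro ⟨i, rfl⟩
    rcases (Fin.le_last i).lt_or_eq with h5 | rfl
    · obtain ⟨h6, h7⟩ := (hW2 _).2 ⟨i, h5, rfl⟩
      exact ⟨Or.inl h6, h7⟩
    · exact ⟨Or.inr (Or.inl (he _)), hdiag _⟩
  · rintro ⟨h2 | h2 | h2, h3⟩
    · obtain ⟨i, -, hi'⟩ := (hW2 ε).1 ⟨h2, h3⟩
      exact ⟨i, hi'.symm⟩
    · exact ⟨Fin.last k, by rw [h2, he]⟩
    · exact absurd (isDiag_of_support s.base p hp' ε h2) h3

end Expansion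

/-! ### From saps to augmenting paths of the contracted graph. -/

section Compression

variable {V : Type*} {G : SimpleGraph V} {M : G.Subgraph} {Δ : ℕ} {s : SearchState V}

theorem exists_crossing (P : ℕ → Prop) {i j : ℕ} (hij : i ≤ j) (h : ¬ (P i ↔ P j)) :
    ∃ m, i ≤ m ∧ m < j ∧ ¬ (P m ↔ P (m + 1)) := by
  induction j, hij using Nat.le_induction with
  | base => exact absurd Iff.rfl h
  | succ j hij ih =>
    by_cases hj : P j ↔ P (j + 1)
    · obtain ⟨m, h1, h2, h3⟩ := ih (fun h' => h (h'.trans hj))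
      exact ⟨m, h1, by omega, h3⟩
    · exact ⟨j, hij, by omega, hj⟩

theorem eq_of_sum_le_one {n : ℕ} {g : ℕ → ℤ} (hg : ∀ i, 0 ≤ g i)
    (h : ∑ i ∈ Finset.range n, g i ≤ 1) {i j : ℕ} (hi : i < n) (hj : j < n) (hi1 : g i = 1)
    (hj1 : g j = 1) : i = j := by
  by_contra hne
  have := Finset.sum_le_sum_of_subset_of_nonneg (f := g) (s := {i, j}) (t := Finset.range n)
    (by intro a ha; simp at ha; rcases ha with rfl | rfl <;> simpa) (fun _ _ _ => hg _)
  rw [Finset.sum_pair hne] at this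
  omega

theorem crossing_sq {f : V → V} {b u v : V} (h : ¬ (f u = b ↔ f v = b)) :
    (inBlock f b u - inBlock f b v) ^ 2 = 1 := by
  unfold inBlock
  by_cases h1 : f u = b <;> by_cases h2 : f v = b <;> simp_all

/-- A shortest augmenting path crosses the boundary of a block at most once with an even and at
most once with an odd position. -/
theorem EndInvariant.crossing_unique [Finite V] (hM : M.IsMatching) (hs : EndInvariant M Δ s)
    {p : ℕ → V} (hp : IsAugmentingSequence M Δ p) {b : V} {i j : ℕ} (hi : i ≤ 2 * Δ)
    (hj : j ≤ 2 * Δ) (hij : Even i ↔ Even j)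
    (hi1 : ¬ (s.base (p i) = b ↔ s.base (p (i + 1)) = b))
    (hj1 : ¬ (s.base (p j) = b ↔ s.base (p (j + 1)) = b)) : i = j := by
  obtain ⟨h1, h2⟩ := (hs.shortest hM hp).2 b
  have h3 := inBlock_nonneg s.base b (p 0)
  have h4 := inBlock_nonneg s.base b (p (2 * Δ + 1))
  rcases Nat.even_or_odd' i with ⟨a, rfl | rfl⟩ <;> rcases Nat.even_or_odd' j with ⟨c, rfl | rfl⟩
  · have := eq_of_sum_le_one (fun _ => sq_nonneg _) h2 (i := a) (j := c) (by omega) (by omega)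
      (crossing_sq hi1) (crossing_sq hj1)
    rw [this]
  · simp [parity_simps] at hij
  · simp [parity_simps] at hij
  · have h5 : oddCrossings s.base Δ p b ≤ 1 := by linarith
    have := eq_of_sum_le_one (fun _ => sq_nonneg _) h5 (i := a) (j := c) (by omega) (by omega)
      (crossing_sq hi1) (crossing_sq hj1)
    rw [this]

/-- A shortest augmenting path visits each block only once. -/
theorem EndInvariant.contiguous [Finite V] (hM : M.IsMatching) (hs : EndInvariant M Δ s)
    {p : ℕ → V} (hp : IsAugmentingSequence M Δ p) {i l j : ℕ} (hil : i ≤ l) (hlj : l ≤ j)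
    (hj : j ≤ 2 * Δ + 1) (h : s.base (p i) = s.base (p j)) : s.base (p l) = s.base (p i) := by
  by_contra hl
  set b := s.base (p i) with hb
  have huniq := fun {i j : ℕ} => hs.crossing_unique hM hp (b := b) (i := i) (j := j)
  have hcross := fun {i j : ℕ} => exists_crossing (fun m => s.base (p m) = b) (i := i) (j := j)
  obtain ⟨m, h1, h2, h3⟩ := hcross hil (by simp [hl, ← hb])
  obtain ⟨n, h4, h5, h6⟩ := hcross hlj (by simp [hl, ← h])
  -- The block is left at `m` and entered again at `n`. Each parity admits only one crossing, so
  -- these two exhaust both parities.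
  have hthree : ∀ a, a ≤ 2 * Δ → a ≠ m → a ≠ n →
      ¬ ¬ (s.base (p a) = b ↔ s.base (p (a + 1)) = b) := by
    intro a ha ham han h7
    have e1 := huniq ha (show m ≤ 2 * Δ by omega)
    have e2 := huniq ha (show n ≤ 2 * Δ by omega)
    have e3 := huniq (show m ≤ 2 * Δ by omega) (show n ≤ 2 * Δ by omega)
    have e4 : ¬ (Even a ↔ Even m) := fun h => ham (e1 h h7 h3)
    have e5 : ¬ (Even a ↔ Even n) := fun h => han (e2 h h7 h6)
    have e6 : ¬ (Even m ↔ Even n) := fun h => by have := e3 h h3 h6; omega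
    by_cases q1 : Even a <;> by_cases q2 : Even m <;> by_cases q3 : Even n <;>
      simp only [q1, q2, q3, not_true_eq_false] at e4 e5 e6
  have h0 : s.base (p 0) = b := by
    by_contra h0
    obtain ⟨a, -, h7, h8⟩ := hcross (Nat.zero_le i) (by simp [h0, ← hb])
    exact hthree a (by omega) (by omega) (by omega) h8
  have h1' : s.base (p (2 * Δ + 1)) = b := by
    by_contra h0
    obtain ⟨a, h7, h8, h9⟩ := hcross hj (by simp [h0, ← h])
    exact hthree a (by omega) (by omega) (by omega) h9
  -- With no third crossing the path starts and ends in the block. The two free ends then force at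
  -- least two even crossings, while at most one is allowed.
  obtain ⟨h7, h8⟩ := (hs.shortest hM hp).2 b
  have h9 : 0 ≤ oddCrossings s.base Δ p b := Finset.sum_nonneg fun _ _ => sq_nonneg _
  have h10 : inBlock s.base b (p 0) = 1 := by simp [inBlock, h0]
  have h11 : inBlock s.base b (p (2 * Δ + 1)) = 1 := by simp [inBlock, h1']
  linarith

/-- The image of a shortest augmenting path is an augmenting path of the contracted graph. -/
theorem EndInvariant.compress [Finite V] (hM : M.IsMatching) (hs : EndInvariant M Δ s) {x y : V}
    {Q : G.Walk x y} (hQ : IsAugmentingPath M Q) (hl : Q.length = 2 * Δ + 1) :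
    FormsAugmentingPath (contractedGraph M (Δ + 1) s) (contractedMatching M (Δ + 1) s)
      (contractedImage s Q) := by
  classical
  obtain ⟨k, hk, hp⟩ := hQ.sequence
  obtain rfl : k = Δ := by omega
  set p := Q.getVert with hpdef
  have hI := hs.invariant
  have hcont := fun {i l j : ℕ} => hs.contiguous hM hp (i := i) (l := l) (j := j)
  have hbase0 := (hI.free _ hp.free_left).2.2
  have hbase1 := (hI.free _ hp.free_right).2.2
  have hne01 : s.base (p 0) ≠ s.base (p (2 * k + 1)) := fun h => by
    rw [hbase0, hbase1] at h
    have := hp.inj (show 0 ≤ 2 * k + 1 by omega) (show 2 * k + 1 ≤ 2 * k + 1 by omega) h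
    omega
  have hconst : ∀ a c, a ≤ c → (∀ m, a ≤ m → m < c → s.base (p m) = s.base (p (m + 1))) →
      s.base (p a) = s.base (p c) := by
    intro a c hac h
    induction c, hac using Nat.le_induction with
    | base => rfl
    | succ c hac ih =>
      exact (ih fun m h1 h2 => h m h1 (by omega)).trans (h c hac (by omega))
  set S := (Finset.range (2 * k + 1)).filter fun i => s.base (p i) ≠ s.base (p (i + 1)) with hS
  have hSmem : ∀ i, i ∈ S ↔ i ≤ 2 * k ∧ s.base (p i) ≠ s.base (p (i + 1)) := fun i => by
    rw [hS, Finset.mem_filter, Finset.mem_range, Nat.lt_succ_iff]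
  have hSne : S.Nonempty := by
    by_contra h
    rw [Finset.not_nonempty_iff_eq_empty] at h
    refine hne01 (hconst 0 _ (Nat.zero_le _) fun m _ hm => ?_)
    by_contra h'
    have := (hSmem m).2 ⟨by omega, h'⟩
    rw [h] at this
    simp at this
  obtain ⟨n, hn⟩ : ∃ n, S.card = n + 1 := ⟨S.card - 1, by have := hSne.card_pos; omega⟩
  set o := S.orderEmbOfFin hn with ho
  have hoS : ∀ j, o j ≤ 2 * k ∧ s.base (p (o j)) ≠ s.base (p (o j + 1)) := fun j =>
    (hSmem _).1 (S.orderEmbOfFin_mem hn j)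
  have hosurj : ∀ i ∈ S, ∃ j, o j = i := fun i hi => by
    have : i ∈ Set.range o := by rw [ho, Finset.range_orderEmbOfFin]; exact hi
    exact this
  have hmono : ∀ {i j}, o i < o j ↔ i < j := fun {i j} => o.lt_iff_lt
  -- `o` lists the positions of the edges between blocks, and `pos` the positions where the path
  -- enters its successive nodes: the start, and the position just after each such edge.
  set pos : Fin (n + 2) → ℕ := Fin.cons 0 fun j => o j + 1 with hpos
  have hpos0 : pos 0 = 0 := rfl
  have hposs : ∀ j : Fin (n + 1), pos j.succ = o j + 1 := fun j => rfl
  have hnocross : ∀ a c, a ≤ c → c ≤ 2 * k + 1 → (∀ j, a ≤ o j → o j < c → False) →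
      s.base (p a) = s.base (p c) := by
    intro a c hac hc h
    refine hconst a c hac fun m h1 h2 => ?_
    by_contra h3
    obtain ⟨j, hj⟩ := hosurj m ((hSmem m).2 ⟨by omega, h3⟩)
    exact h j (by omega) (by omega)
  have hcast : ∀ j : Fin (n + 1), s.base (p (pos j.castSucc)) = s.base (p (o j)) := by
    intro j
    cases j using Fin.cases with
    | zero =>
      refine hnocross 0 (o 0) (Nat.zero_le _) (by have := (hoS 0).1; omega) fun j _ h => ?_
      exact absurd (hmono.1 h) (Fin.not_lt_zero j)
    | succ i =>
      have h1 : pos i.succ.castSucc = o i.castSucc + 1 := hposs i.castSucc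
      rw [h1]
      refine hnocross _ _ (hmono.2 Fin.castSucc_lt_succ) (by have := (hoS i.succ).1; omega)
        fun j h2 h3 => ?_
      have h4 : i.castSucc < j := hmono.1 h2
      have h5 : j < i.succ := hmono.1 h3
      rw [Fin.lt_def] at h4 h5
      simp at h4 h5
      omega
  have hlt : ∀ a b : Fin (n + 2), a < b → s.base (p (pos a)) ≠ s.base (p (pos b)) := by
    intro a b hab h
    cases b using Fin.cases with
    | zero => exact absurd hab (Fin.not_lt_zero a)
    | succ b =>
      have h1 : pos a ≤ o b := by
        cases a using Fin.cases with
        | zero => exact Nat.zero_le _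
        | succ a => exact hmono.2 (Fin.succ_lt_succ_iff.1 hab)
      rw [hposs] at h
      -- Returning to an earlier node would, by contiguity, place both ends of the edge at `o b` in
      -- one block.
      have := hcont h1 (Nat.le_succ (o b)) (by have := (hoS b).1; omega) h
      exact (hoS b).2 (this.trans h)
  have hlink : ∀ j : Fin (n + 1), (contractedGraph M (k + 1) s).IsLink s(p (o j), p (o j + 1))
      (s.base (p (pos j.castSucc))) (s.base (p (pos j.succ))) := by
    intro j
    obtain ⟨h1, h2⟩ := hoS j
    rw [hI.isLink_iff]
    refine ⟨_, _, rfl, hp.adj _ h1, h2, ?_, hcast j, rfl⟩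
    rcases Nat.even_or_odd' (o j) with ⟨a, ha | ha⟩
    · rw [ha] at h1 h2 ⊢
      exact Or.inr ((hs.shortest hM hp).1 a (by omega) h2)
    · exact Or.inl ((hp.mem _ h1).2 (by rw [ha]; exact odd_two_mul_add_one a))
  have hodd : ∀ j, s(p (o j), p (o j + 1)) ∈ contractedMatching M (k + 1) s ↔ Odd (o j) :=
    fun j => by
      rw [mem_contractedMatching (hlink j), SimpleGraph.Subgraph.mem_edgeSet, hp.mem _ (hoS j).1]
  refine ⟨n, fun j => s.base (p (pos j)), fun j => s(p (o j), p (o j + 1)), ?_, hlink, ?_, ?_, ?_,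
    ?_⟩
  · intro a b hab
    rcases lt_trichotomy a b with h | h | h
    · exact absurd hab (hlt a b h)
    · exact h
    · exact absurd hab.symm (hlt b a h)
  · intro i
    rw [hodd, hodd]
    have h1 := hoS i.castSucc
    have h2 := hoS i.succ
    have h3 : s.base (p (o i.castSucc + 1)) = s.base (p (o i.succ)) := hcast i.succ
    have h4 : o i.castSucc < o i.succ := hmono.2 Fin.castSucc_lt_succ
    -- Both edges cross the boundary of the node between them, and two different crossings of one
    -- block have different parities; this is alternation in H.
    have h5 : ¬ (Even (o i.castSucc) ↔ Even (o i.succ)) := fun h => by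
      have := hs.crossing_unique hM hp (b := s.base (p (o i.succ))) h1.1 h2.1 h
        (by rw [h3]; rw [h3] at h1; simp [h1.2]) (by simp [h2.2.symm])
      omega
    rw [← Nat.not_even_iff_odd, ← Nat.not_even_iff_odd]
    tauto
  · rw [hI.isFreeIn_iff]
    dsimp only
    rw [hpos0, hbase0]
    exact hp.free_left
  · rw [hI.isFreeIn_iff]
    dsimp only
    have h1 : s.base (p (pos (Fin.last (n + 1)))) = s.base (p (2 * k + 1)) := by
      rw [← Fin.succ_last, hposs]
      refine hnocross _ _ (by have := (hoS (Fin.last n)).1; omega) le_rfl fun j h _ => ?_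
      have : Fin.last n < j := hmono.1 h
      exact absurd this (not_lt.2 (Fin.le_last j))
    rw [h1, hbase1]
    exact hp.free_right
  · ext ε
    induction ε with
    | _ u v =>
      simp only [contractedImage, Set.mem_ofPred_eq, SimpleGraph.Walk.mk_mem_edges_iff_exists,
        Set.mem_range]
      constructor
      · rintro ⟨⟨i, hi, h1⟩, h2⟩
        rw [← h1, Sym2.map_mk, Sym2.mk_isDiag_iff] at h2
        obtain ⟨j, hj⟩ := hosurj i ((hSmem i).2 ⟨by omega, h2⟩)
        exact ⟨j, by rw [hj]; exact h1⟩
      · rintro ⟨j, hj⟩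
        obtain ⟨h1, h2⟩ := hoS j
        refine ⟨⟨o j, by omega, hj⟩, ?_⟩
        rw [← hj, Sym2.map_mk, Sym2.mk_isDiag_iff]
        exact h2

end Compression

end CardMatching

/-! ### The lemma: expansion and compression combined. -/

theorem mainTheorem2 {V : Type*} [Finite V] (G : SimpleGraph V) (M : G.Subgraph)
    (hM : M.IsMatching) (Δ : ℕ) (s : CardMatching.SearchState V)
    (hs : CardMatching.IsStateBeforeBreakthrough M Δ s) (P : Set (Sym2 V)) :
    CardMatching.FormsAugmentingPath (CardMatching.contractedGraph M Δ s)
        (CardMatching.contractedMatching M Δ s) P ↔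
      ∃ (x y : V) (Q : G.Walk x y), CardMatching.IsShortestAugmentingPath M Q ∧
        P = CardMatching.contractedImage s Q := by
  obtain ⟨h1, h2, h3⟩ := hs
  obtain ⟨δ, rfl⟩ : ∃ δ, Δ = δ + 1 := ⟨Δ - 1, by omega⟩
  have hend := h2.endInvariant hM
  rw [Nat.add_sub_cancel] at hend
  simp only [hend.isShortest_iff hM h3]
  constructor
  · intro hP
    obtain ⟨x, y, Q, h4, h5, h6⟩ :=
      (hend.invariant.mono (Nat.le_succ δ)).expand hend.invariant hP
    exact ⟨x, y, Q, ⟨h4, h5⟩, h6⟩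
  · rintro ⟨x, y, Q, ⟨h4, h5⟩, rfl⟩
    exact hend.compress hM h4 h5
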